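/- **Setting.** Logarithms are to base $2$, $h(x)=-x\log|x|-(1-x)\log|1-x|$ with $0\log 0=0$ (the binary entropy for $0\le x\le 1$), and $d_H$ is the Hamming distance. For subnormalized states (positive operators of trace at most $1$) on a Hilbert space let $d(\rho,\tau)=\frac12\|\rho-\tau\|_1+\frac12|\operatorname{tr}\rho-\operatorname{tr}\tau|$, and define $d(P,Q)$ for subnormalized distributions on a finite set as the classical special case. Put $H_{\min}(Z)_Q=-\log\max_z Q(z)$ and $H_{\min}(X|B)_\rho=\sup_\tau\sup\{-\lambda\in\mathbb R:\rho_{XB}\le 2^{\lambda}\,\mathbb 1_X\otimes\tau_B\}$, with $\tau$ ranging over the states on $B$; the smooth versions $H^\varepsilon_{\min}$ are the suprema of these quantities over all subnormalized distributions (states) within $d$-distance $\varepsilon$. **Model.** Let $n\in\mathbb N$ and $\theta=(p,\varepsilon_A,l_A,\varepsilon_B,l_B)$ with $0<p<\frac12$ and $\varepsilon_A,l_A,\varepsilon_B,l_B\ge 0$. In the $(n,\theta)$-unstructured noisy channel model a noiseless channel is available together with a noisy channel from Alice to Bob, as follows. If both parties are honest, the noisy channel is the $n$-fold binary symmetric channel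 with transition probability $p$. A dishonest Alice may replace it by any channel $W^A$ from an arbitrary set $\hat{\mathcal X}$ to $\{0,1\}^n$ such that $H_{\min}^{\varepsilon_A}(Z)_{W^A(x)}\ge l_A$ for all $x\in\hat{\mathcal X}$. A dishonest Bob may replace it by any classical-quantum channel $W^B$ from $\{0,1\}^n$ to the states of an arbitrary quantum system $B$ such that $H_{\min}^{\varepsilon_B}(X|B)_\rho\ge l_B$ for $\rho=2^{-n}\sum_x|x\rangle\langle x|\otimes W^B(x)$. **Protocol $\Phi[\varepsilon,C,F]$.** Let $\varepsilon>0$. Let $\mathcal M$ be a finite message set with an additive group structure. Let $C\subseteq\{0,1\}^n$ be a linear code with minimum distance $2\sigma n<n/2$, with a fixed representative $x_{C'}$ of each coset $C'$ of $C$. Let $F=\{f_s:C\to\mathcal M\}_{s\in\mathcal S}$, with $\mathcal S$ finite and non-empty, be a balanced 2-universal hash family, i.e. for each $s$ all fibres of $f_s$ have the same size, and $\Pr_s[f_s(c_1)=f_s(c_2)]\le 1/|\mathcal M|$ for $c_1\ne c_2$. Commit phase: to commit to $m$, Alice draws $s\in\mathcal S$, $\bar m\in\mathcal M$ and a coset $C'$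 uniformly and independently, and then $x$ uniformly from $f_s^{-1}(m+\bar m)$; she sends $x+x_{C'}$ through the noisy channel and then $(s,\bar m,C')$ noiselessly; Bob keeps $(s,\bar m,C')$ and the channel output $z$. Reveal phase: Alice announces $(m,x)$; Bob outputs $m$ and accepts iff $x\in C$, $f_s(x)=m+\bar m$ and $n(p-\varepsilon)\le d_H(x+x_{C'},z)\le n(p+\varepsilon)$. **Parameters.** $\delta_c$ is the maximum over $m$ of $1-\Pr[\text{Bob accepts and outputs } m]$ in the honest run on $m$. $\delta_h$ is the supremum of $d(\rho_{B'|m},\rho_{B'|m'})$ over all messages $m\ne m'$ and all channels $W^B$ allowed to a dishonest Bob, where $\rho_{B'|m}$ is the joint state of the channel output $B$ and of $(s,\bar m,C')$ when Alice commits to $m$. $\delta_b$ is the supremum, over all channels $W^A$ allowed to a dishonest Alice, all joint distributions of channel input, noiseless message $(s,\bar m,C')$ and extra information, and all pairs of randomized reveal strategies based on these, of the probability that both resulting announcements are accepted by Bob for the same commitment and carry different messages. **Theorem.** The protocol $\Phi[\varepsilon,C,F]$ satisfies $$\delta_c\le 8\cdot 2^{-n\varepsilon^2},\qquad \delta_h\le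 2\cdot 2^{\frac12(n+\log|\mathcal M|-\log|C|-l_B)}+8\varepsilon_B,$$ and, if moreover $\varepsilon<\frac12-p$, $$\delta_b\le(\sqrt2\,\varepsilon n+1)^2\,2^{\,n\left[(1-2\sigma)h\left(\frac{p-\sigma+\varepsilon}{1-2\sigma}\right)+2\sigma\right]-l_A}+\varepsilon_A .$$ -/

import Mathlib

open scoped ENNReal

universe u v w₁ w₂

noncomputable section

namespace UsNC

/-! ## Operators on a Hilbert space -/

section Operators

variable {H : Type*} [NormedAddCommGroup H] [InnerProductSpace ℂ H]

/-- The trace norm `‖T‖₁`, as the supremum of `∑ i, |⟪e i, T (f i)⟫|` over all finite orthonormal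
families `e`, `f` of the same length. It equals `tr |T|`, and is `∞` exactly when `T` is not
trace class. -/
def traceNorm (T : H →L[ℂ] H) : ℝ≥0∞ :=
  ⨆ (k : ℕ) (e : Fin k → H) (f : Fin k → H) (_ : Orthonormal ℂ e) (_ : Orthonormal ℂ f),
    ∑ i, ‖inner ℂ (e i) (T (f i))‖ₑ

variable [CompleteSpace H]

/-- The trace of a positive operator, `∑ i, ⟪b i, T (b i)⟫` for a Hilbert basis `b`
(for positive `T` the value, possibly `∞`, does not depend on the basis). -/
def posTrace (T : H →L[ℂ] H) : ℝ≥0∞ :=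
  ∑' i : (exists_hilbertBasis ℂ H).choose,
    ENNReal.ofReal (inner ℂ (i : H) (T (i : H))).re

/-- Normalized states, the set `D(H)`. -/
def IsState (ρ : H →L[ℂ] H) : Prop :=
  ρ.IsPositive ∧ posTrace ρ = 1

/-- Subnormalized states, the set `D_•(H)`. -/
def IsSubState (ρ : H →L[ℂ] H) : Prop :=
  ρ.IsPositive ∧ posTrace ρ ≤ 1

/-- Generalized trace distance of (sub)normalized states. -/
def gtd (ρ σ : H →L[ℂ] H) : ℝ≥0∞ :=
  2⁻¹ * traceNorm (ρ - σ) +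
    2⁻¹ * ENNReal.ofReal |(posTrace ρ).toReal - (posTrace σ).toReal|

/-- `D_∞(ρ ‖ σ) = inf {r ∈ ℝ : ρ ≤ 2 ^ r σ}`, where `≤` is the Loewner order. -/
def maxDiv (ρ σ : H →L[ℂ] H) : EReal :=
  ⨅ (r : ℝ) (_ : ρ ≤ (((2 : ℝ) ^ r : ℝ) : ℂ) • σ), (r : EReal)

/-- The Hilbert space `ℂ^X ⊗ H`, realised as the `ℓ²` direct sum of copies of `H` indexed
by `X`. -/
abbrev CTensor (X : Type*) (H : Type*) : Type _ := PiLp 2 (fun _ : X => H)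

/-- The block-diagonal operator `∑ x, |x⟩⟨x| ⊗ T x` on `ℂ^X ⊗ H`. -/
def blockDiag {X : Type*} [Fintype X] (T : X → (H →L[ℂ] H)) : CTensor X H →L[ℂ] CTensor X H :=
  ((PiLp.continuousLinearEquiv 2 ℂ (fun _ : X => H)).symm : (X → H) →L[ℂ] CTensor X H) ∘L
    ContinuousLinearMap.pi (fun x => T x ∘L PiLp.proj 2 (fun _ : X => H) x)

/-- Conditional min-entropy `H_min(X|B)` of an operator on `ℂ^X ⊗ H`: the supremum over states
`σ` on `H` of `-D_∞(ρ ‖ 1 ⊗ σ)`. -/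
def condMinEntropy {X : Type*} [Fintype X] (ρ : CTensor X H →L[ℂ] CTensor X H) : EReal :=
  ⨆ (σ : H →L[ℂ] H) (_ : IsState σ), -maxDiv ρ (blockDiag fun _ : X => σ)

/-- Smooth conditional min-entropy `H_min^ε(X|B)`; smoothing is over all subnormalized states of
the bipartite system. -/
def smoothCondMinEntropy {X : Type*} [Fintype X] (ε : ℝ)
    (ρ : CTensor X H →L[ℂ] CTensor X H) : EReal :=
  ⨆ (ρ' : CTensor X H →L[ℂ] CTensor X H) (_ : IsSubState ρ')
    (_ : gtd ρ' ρ ≤ ENNReal.ofReal ε), condMinEntropy ρ'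

end Operators

/-! ## Classical min-entropy -/

section Classical

variable {α : Type*} [Fintype α]

/-- Subnormalized distributions on a finite set. -/
def IsSubDist (Q : α → ℝ) : Prop :=
  (∀ a, 0 ≤ Q a) ∧ ∑ a, Q a ≤ 1

/-- Generalized trace distance of (sub)normalized distributions. -/
def classicalGtd (P Q : α → ℝ) : ℝ :=
  2⁻¹ * ∑ a, |P a - Q a| + 2⁻¹ * |∑ a, (P a - Q a)|

/-- Min-entropy `-log₂ max Q = -inf {r ∈ ℝ : ∀ b, Q b ≤ 2 ^ r}`. -/
def minEntropy {β : Type*} (Q : β → ℝ) : EReal :=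
  -⨅ (r : ℝ) (_ : ∀ b, Q b ≤ (2 : ℝ) ^ r), (r : EReal)

/-- Smooth min-entropy `H_min^ε`. -/
def smoothMinEntropy (ε : ℝ) (P : α → ℝ) : EReal :=
  ⨆ (Q : α → ℝ) (_ : IsSubDist Q) (_ : classicalGtd Q P ≤ ε), minEntropy Q

/-- Binary entropy with logarithm to base `2`. -/
def binEntropy₂ (x : ℝ) : ℝ := Real.binEntropy x / Real.log 2

end Classical

/-! ## The unstructured noisy channel model -/

/-- Binary words of length `n`. -/
abbrev Word (n : ℕ) : Type := Fin n → ZMod 2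

/-- The parameter list `θ = (p, ε_A, l_A, ε_B, l_B)`. -/
structure Params where
  p : ℝ
  εA : ℝ
  lA : ℝ
  εB : ℝ
  lB : ℝ
  p_pos : 0 < p
  p_lt : p < 1 / 2
  εA_nonneg : 0 ≤ εA
  lA_nonneg : 0 ≤ lA
  εB_nonneg : 0 ≤ εB
  lB_nonneg : 0 ≤ lB

theorem bsc_sum (θ : Params) (n : ℕ) (x : Word n) :
    ∑ z : Word n, ∏ i, (if z i = x i then ENNReal.ofReal (1 - θ.p) else ENNReal.ofReal θ.p)
      = 1 := by
  have key : ∀ a : ZMod 2, ∑ b : ZMod 2,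
      (if b = a then ENNReal.ofReal (1 - θ.p) else ENNReal.ofReal θ.p) = 1 := by
    have h0 := θ.p_pos
    have h1 := θ.p_lt
    have h2 : ENNReal.ofReal (1 - θ.p) + ENNReal.ofReal θ.p = 1 := by
      rw [← ENNReal.ofReal_add (by linarith) h0.le]; simp
    intro a
    have h10 : (1 : ZMod 2) ≠ 0 := by decide
    have ha : a = 0 ∨ a = 1 := by revert a; decide
    rw [show (Finset.univ : Finset (ZMod 2)) = {0, 1} from rfl, Finset.sum_pair h10.symm]
    rcases ha with rfl | rfl
    · rw [if_pos rfl, if_neg h10, h2]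
    · rw [if_pos rfl, if_neg h10.symm, add_comm, h2]
  have h := Fintype.prod_sum (fun (i : Fin n) (b : ZMod 2) =>
    if b = x i then ENNReal.ofReal (1 - θ.p) else ENNReal.ofReal θ.p)
  rw [← h]
  simp [key]

/-- Honest channel: the `n`-fold binary symmetric channel with transition probability `p`. -/
def bsc (θ : Params) (n : ℕ) (x : Word n) : PMF (Word n) :=
  PMF.ofFintype
    (fun z => ∏ i, (if z i = x i then ENNReal.ofReal (1 - θ.p) else ENNReal.ofReal θ.p))
    (bsc_sum θ n x)

/-- A channel that a dishonest Alice may use: every output distribution has smooth min-entropy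
at least `l_A`. The input set is arbitrary. -/
def IsAliceChannel (θ : Params) {n : ℕ} {X : Type*} (WA : X → PMF (Word n)) : Prop :=
  ∀ x, (θ.lA : EReal) ≤ smoothMinEntropy θ.εA (fun z => (WA x z).toReal)

/-- A cq channel that a dishonest Bob may use: all outputs are states, and for a uniformly random
input word the smooth min-entropy of the input given the output is at least `l_B`. -/
def IsBobChannel (θ : Params) {n : ℕ} {H : Type*} [NormedAddCommGroup H] [InnerProductSpace ℂ H]
    [CompleteSpace H] (WB : Word n → (H →L[ℂ] H)) : Prop :=
  (∀ x, IsState (WB x)) ∧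
    (θ.lB : EReal) ≤ smoothCondMinEntropy θ.εB (blockDiag fun x => (((2 : ℂ) ^ n)⁻¹) • WB x)

/-! ## String commitment and its error parameters -/

/-- A string commitment protocol whose honest communication goes from Alice to Bob only.
`M` is the message set, `T` the noiseless commit-phase message, `R` Alice's private memory,
`A` the reveal-phase message. In the commit phase Alice samples a word for the noisy channel, a
noiseless message and her memory; Bob keeps the channel output and the noiseless message. In the
reveal phase Alice sends one message, and Bob outputs a message and accepts or rejects. -/
structure Protocol (n : ℕ) (M T R A : Type*) where
  commit : M → PMF (Word n × T × R)
  reveal : M → R → A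
  output : Word n → T → A → M
  accept : Word n → T → A → Prop

section Errors

variable {n : ℕ} {M T R A : Type*}

/-- The honest run on message `m`: channel output, noiseless message, reveal message. -/
def honestRun (θ : Params) (Φ : Protocol n M T R A) (m : M) : PMF (Word n × T × A) :=
  (Φ.commit m).bind fun w => (bsc θ n w.1).map fun z => (z, w.2.1, Φ.reveal m w.2.2)

/-- The completeness parameter `δ_c`. -/
def completenessError (θ : Params) (Φ : Protocol n M T R A) : ℝ≥0∞ :=
  ⨆ m : M, 1 - (honestRun θ Φ m).toOuterMeasure
    {v | Φ.output v.1 v.2.1 v.2.2 = m ∧ Φ.accept v.1 v.2.1 v.2.2}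

/-- The state of Bob's registers (quantum channel output and noiseless message) at the end of the
commit phase when Alice commits to `m` and Bob uses the cq channel `WB`. -/
def bobState [Fintype T] {H : Type*} [NormedAddCommGroup H] [InnerProductSpace ℂ H]
    (Φ : Protocol n M T R A) (WB : Word n → (H →L[ℂ] H)) (m : M) :
    CTensor T H →L[ℂ] CTensor T H :=
  blockDiag fun t => ∑ x : Word n,
    (((((Φ.commit m).map fun w => (w.1, w.2.1)) (x, t)).toReal : ℝ) : ℂ) • WB x

/-- The hiding parameter `δ_h`: the supremum over all Hilbert spaces, all channels allowed to a
dishonest Bob, and all pairs of distinct messages. -/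
def hidingError [Fintype T] (θ : Params) (Φ : Protocol n M T R A) : ℝ≥0∞ :=
  ⨆ (H : Type u) (_ : NormedAddCommGroup H) (_ : InnerProductSpace ℂ H) (_ : CompleteSpace H)
    (WB : Word n → (H →L[ℂ] H)) (_ : IsBobChannel θ WB) (m : M) (m' : M) (_ : m ≠ m'),
    gtd (bobState Φ WB m) (bobState Φ WB m')

/-- A run with a dishonest Alice: `aC` samples an input of the channel `WA`, a noiseless message
and extra information; `a₀` and `a₁` are the two reveal strategies, played against the same
commitment. -/
def cheatRun {X Q : Type*} (WA : X → PMF (Word n)) (aC : PMF (X × T × Q))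
    (a₀ a₁ : X × T × Q → PMF A) : PMF (Word n × T × A × A) :=
  aC.bind fun v => (WA v.1).bind fun z => (a₀ v).bind fun b₀ => (a₁ v).map fun b₁ =>
    (z, v.2.1, b₀, b₁)

/-- The binding parameter `δ_b`: the supremum over all channels allowed to a dishonest Alice and
all her commit and reveal strategies. -/
def bindingError (θ : Params) (Φ : Protocol n M T R A) : ℝ≥0∞ :=
  ⨆ (X : Type u) (WA : X → PMF (Word n)) (_ : IsAliceChannel θ WA) (Q : Type u)
    (aC : PMF (X × T × Q)) (a₀ : X × T × Q → PMF A) (a₁ : X × T × Q → PMF A),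
    (cheatRun WA aC a₀ a₁).toOuterMeasure
      {v | Φ.accept v.1 v.2.1 v.2.2.1 ∧ Φ.accept v.1 v.2.1 v.2.2.2 ∧
        Φ.output v.1 v.2.1 v.2.2.1 ≠ Φ.output v.1 v.2.1 v.2.2.2}

end Errors

/-! ## The protocol `Φ[ε, C, F]` -/

/-- The conditional typical set of the binary symmetric channel. -/
def typicalSet (p ε : ℝ) {n : ℕ} (x : Word n) : Set (Word n) :=
  {z | n * (p - ε) ≤ (hammingDist x z : ℝ) ∧ (hammingDist x z : ℝ) ≤ n * (p + ε)}

/-- Balanced 2-universal families of hash functions `D → M` with seeds in `S`. -/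
structure BalancedUHF (S D M : Type*) where
  f : S → D → M
  balanced : ∀ s m m', Nat.card {c // f s c = m} = Nat.card {c // f s c = m'}
  universal : ∀ c₁ c₂, c₁ ≠ c₂ →
    (Nat.card {s // f s c₁ = f s c₂} : ℝ) / Nat.card S ≤ 1 / Nat.card M

theorem BalancedUHF.card_eq {S D M : Type*} [Fintype D] [Fintype M]
    (F : BalancedUHF S D M) (s : S) (m : M) :
    Fintype.card D = Fintype.card M * Nat.card {c // F.f s c = m} := by
  classical
  rw [Fintype.card_congr (Equiv.sigmaFiberEquiv (F.f s)).symm, Fintype.card_sigma]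
  rw [Finset.sum_congr rfl (fun m' _ => ?_)]
  · rw [Finset.sum_const, Finset.card_univ, smul_eq_mul]
  · rw [← Nat.card_eq_fintype_card]; exact F.balanced s m' m

open Classical in
theorem BalancedUHF.invMap_sum {S D M : Type*} [Fintype D] [Nonempty D] [Fintype M]
    (F : BalancedUHF S D M) (s : S) (m : M) :
    ∑ c : D, (if F.f s c = m then (Fintype.card M : ℝ≥0∞) / Fintype.card D else 0) = 1 := by
  have h := F.card_eq s m
  rw [Nat.card_eq_fintype_card, Fintype.card_subtype] at h
  rw [← Finset.sum_filter, Finset.sum_const, nsmul_eq_mul, ← mul_div_assoc, mul_comm,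
    ← Nat.cast_mul, ← h]
  exact ENNReal.div_self (by simp) (by simp)

open Classical in
/-- The random map `Γ_s`: `Γ_s(c|m) = |M| / |D|` if `f_s(c) = m`, and `0` otherwise. -/
def BalancedUHF.invMap {S D M : Type*} [Fintype D] [Nonempty D] [Fintype M]
    (F : BalancedUHF S D M) (s : S) (m : M) : PMF D :=
  PMF.ofFintype
    (fun c => if F.f s c = m then (Fintype.card M : ℝ≥0∞) / Fintype.card D else 0)
    (F.invMap_sum s m)

/-- Linear codes of length `n`. -/
abbrev Code (n : ℕ) : Type := Submodule (ZMod 2) (Word n)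

/-- The set of cosets of a code. -/
abbrev Coset {n : ℕ} (C : Code n) : Type := Word n ⧸ C

instance {n : ℕ} (C : Code n) : Fintype C := Fintype.ofFinite C

instance {n : ℕ} (C : Code n) : Fintype (Coset C) := Fintype.ofFinite (Coset C)

/-- `d` is the minimum Hamming distance between two distinct codewords of `C`. -/
def IsMinDist {n : ℕ} (C : Code n) (d : ℕ) : Prop :=
  IsLeast {k | ∃ x ∈ C, ∃ y ∈ C, x ≠ y ∧ hammingDist x y = k} d

/-- The protocol `Φ[ε, C, F]`, for the fixed coset representatives `rep`.
Commit phase: Alice draws a seed `s`, a mask `k` and a coset `q` uniformly, draws a codeword `c`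
from `Γ_s(m + k)`, sends `c + rep q` through the noisy channel and `(s, k, q)` noiselessly.
Reveal phase: Alice announces `(m, c)`. Bob outputs `m` and accepts if the announced word lies in
`C`, hashes to `m + k`, and the channel output is typical for its shift by `rep q`. -/
def protocol {n : ℕ} {M S : Type*} [AddGroup M] [Fintype M] [Fintype S] [Nonempty S]
    (θ : Params) (ε : ℝ) (C : Code n) (rep : Coset C → Word n) (F : BalancedUHF S C M) :
    Protocol n M (S × M × Coset C) (Word n) (M × Word n) where
  commit m :=
    (PMF.uniformOfFintype S).bind fun s =>
    (PMF.uniformOfFintype M).bind fun k =>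
    (PMF.uniformOfFintype (Coset C)).bind fun q =>
    (F.invMap s (m + k)).map fun c => ((c : Word n) + rep q, (s, k, q), (c : Word n))
  reveal m c := (m, c)
  output _ _ a := a.1
  accept z t a := ∃ hc : a.2 ∈ C, F.f t.1 ⟨a.2, hc⟩ = a.1 + t.2.1 ∧
    z ∈ typicalSet θ.p ε (a.2 + rep t.2.2)

end UsNC

end

/-!
The three bounds are independent of each other.

*Completeness.* The honest announcement passes the two algebraic tests, so only the typicality of
the channel output can fail. Hoeffding's inequality bounds this (`bsc_compl_typicalSet_le`).

*Binding.* Two accepted announcements of different messages come with different codewords, so the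
channel output lies in the intersection of two Hamming balls of radius `n (p + ε)` whose centres
have distance at least `d = 2 σ n`. Weighting each word `z` with `r ^ (d(x, z) + d(y, z))` and
optimising over `r` bounds this intersection by `2 ^ (n ((1 - 2σ) h(u) + 2σ))`, where
`u = (p - σ + ε) / (1 - 2σ)` (`card_inter_hammingBall_le_binEntropy`). As Alice's announcements do
not depend on the channel output given her view, the smooth min-entropy of the output turns the
cardinality into a probability (`sum_le_of_le_smoothMinEntropy`).

*Hiding.* Bob's state for the message `m` is compared with his state for a uniformly random hash
value. The difference is `∑ t, |t⟩⟨t| ⊗ ∑ x, a t x • ρ x`, where `ρ x = 2⁻ⁿ W x` and `a` is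
`hashCoeff`. By pinching the smoothing state one may replace the `ρ x` by positive operators
`A x ≤ q τ` with `τ` a state, at a cost linear in the smoothing parameter. The leftover hash bound
`sum_inner_le_of_le_state` is Cauchy–Schwarz for the form of `τ + δ`: with `R = (τ + δ)⁻¹` and
`T t = ∑ x, a t x • A x`, the trace norm of the `T t` is controlled by `tr (∑ t, T t * R * T t)`,
where `A x * R * A x ≤ q A x`, and the Gram matrix `aᵀa` has small norm. Its absolute row sums are
computed from universality, which makes the off-diagonal entries nonpositive, and balancedness,
which makes the rows sum to zero (`BalancedUHF.sum_abs_excess_le`); the triangle inequality for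
these row sums costs a factor `√2` compared with an argument through `τ ^ (-1/4)`, and the factor
`2` in the claim absorbs it.

The trace norm is a supremum over finite orthonormal families and the trace a sum over a Hilbert
basis. Both are handled through Bessel families (`IsBessel`): these are what an orthonormal family
of `ℂ^X ⊗ H` becomes in a coordinate `x`, and traces and trace norms still bound sums along them
(`IsBessel.tsum_inner_le`, `IsBessel.sum_inner_le_traceNorm`).
-/

noncomputable section

namespace UsNC

/-! ### Bessel families and the trace of a positive operator -/

section Bessel

variable {H : Type*} [NormedAddCommGroup H] [InnerProductSpace ℂ H]

/-- A family `u` satisfying Bessel's inequality `∑ i, |⟪u i, v⟫|² ≤ ‖v‖²`, such as the image of an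
orthonormal family under a contraction. -/
def IsBessel {ι : Type*} (u : ι → H) : Prop :=
  ∀ v, ∑' i, ‖inner ℂ (u i) v‖ₑ ^ 2 ≤ ‖v‖ₑ ^ 2

/-- A family `u` satisfying Parseval's identity `∑ i, |⟪u i, v⟫|² = ‖v‖²`, such as the image of an
orthonormal basis under a coisometry. -/
def IsParseval {ι : Type*} (u : ι → H) : Prop :=
  ∀ v, ∑' i, ‖inner ℂ (u i) v‖ₑ ^ 2 = ‖v‖ₑ ^ 2

theorem enorm_sq_eq_ofReal {E : Type*} [SeminormedAddGroup E] (x : E) :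
    ‖x‖ₑ ^ 2 = ENNReal.ofReal (‖x‖ ^ 2) := by
  rw [← ofReal_norm, ENNReal.ofReal_pow (norm_nonneg _)]

theorem isParseval_hilbertBasis {ι : Type*} (b : HilbertBasis ι ℂ H) :
    IsParseval (fun i => b i) := by
  intro v
  have h := b.hasSum_inner_mul_inner v v
  have h2 : HasSum (fun i => ‖inner ℂ (b i) v‖ ^ 2) (‖v‖ ^ 2) := by
    have h3 := Complex.hasSum_re h
    convert h3 using 1
    · funext i
      rw [← inner_conj_symm v (b i), mul_comm, Complex.mul_conj, Complex.ofReal_re,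
        Complex.normSq_eq_norm_sq]
    · exact (inner_self_eq_norm_sq (𝕜 := ℂ) v).symm
  simp only [enorm_sq_eq_ofReal]
  rw [← ENNReal.ofReal_tsum_of_nonneg (fun _ => by positivity) h2.summable, h2.tsum_eq]

theorem _root_.Orthonormal.isBessel {ι : Type*} {u : ι → H} (hu : Orthonormal ℂ u) :
    IsBessel u := by
  intro v
  simp only [enorm_sq_eq_ofReal]
  rw [← ENNReal.ofReal_tsum_of_nonneg (fun _ => by positivity) (hu.inner_products_summable v)]
  exact ENNReal.ofReal_le_ofReal (hu.tsum_inner_products_le v)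

/-- The Hilbert basis over which `posTrace` sums. -/
def traceBasis (H : Type*) [NormedAddCommGroup H] [InnerProductSpace ℂ H] [CompleteSpace H] :
    HilbertBasis (exists_hilbertBasis ℂ H).choose ℂ H :=
  (exists_hilbertBasis ℂ H).choose_spec.choose

variable [CompleteSpace H]

theorem posTrace_eq (T : H →L[ℂ] H) :
    posTrace T = ∑' i, ENNReal.ofReal
      (inner ℂ (traceBasis H i) (T (traceBasis H i))).re := by
  have h : ⇑(traceBasis H) = ((↑) : (exists_hilbertBasis ℂ H).choose → H) :=
    (exists_hilbertBasis ℂ H).choose_spec.choose_spec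
  rw [h]; rfl

/-- The symmetric square root of a positive operator, in the pointwise form used below. -/
theorem exists_sqrt {A : H →L[ℂ] H} (hA : A.IsPositive) :
    ∃ S : H →L[ℂ] H, (∀ x y, inner ℂ (S x) y = inner ℂ x (S y)) ∧ ∀ x, S (S x) = A x := by
  have h0 : 0 ≤ A := (ContinuousLinearMap.nonneg_iff_isPositive A).2 hA
  refine ⟨CFC.sqrt A, ?_, fun x => ?_⟩
  · have := (ContinuousLinearMap.nonneg_iff_isPositive _).1 (CFC.sqrt_nonneg A)
    exact this.inner_left_eq_inner_right
  · rw [← mul_apply_eq_comp, CFC.sqrt_mul_sqrt_self A h0]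

/-- For `A = S²`, both orders of summing the squared matrix elements of `S` between the family `u`
and a Hilbert basis. -/
theorem tsum_inner_eq {ι : Type*} (u : ι → H) {A S : H →L[ℂ] H}
    (hS : ∀ x y, inner ℂ (S x) y = inner ℂ x (S y)) (hSA : ∀ x, S (S x) = A x) :
    ∑' i, ENNReal.ofReal (inner ℂ (u i) (A (u i))).re =
      ∑' b, ∑' i, ‖inner ℂ (u i) (S (traceBasis H b))‖ₑ ^ 2 := by
  rw [ENNReal.tsum_comm]
  refine tsum_congr fun i => ?_
  rw [← hSA, ← hS, show (inner ℂ (S (u i)) (S (u i))).re = ‖S (u i)‖ ^ 2 from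
    inner_self_eq_norm_sq (𝕜 := ℂ) _, ← enorm_sq_eq_ofReal,
    ← isParseval_hilbertBasis (traceBasis H)]
  refine tsum_congr fun b => ?_
  rw [← hS, ← inner_conj_symm, enorm_sq_eq_ofReal, enorm_sq_eq_ofReal, RCLike.norm_conj]

theorem posTrace_eq_tsum_enorm {A S : H →L[ℂ] H}
    (hS : ∀ x y, inner ℂ (S x) y = inner ℂ x (S y)) (hSA : ∀ x, S (S x) = A x) :
    posTrace A = ∑' b, ‖S (traceBasis H b)‖ₑ ^ 2 := by
  rw [posTrace_eq, tsum_inner_eq _ hS hSA]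
  exact tsum_congr fun b => isParseval_hilbertBasis (traceBasis H) _

theorem IsBessel.tsum_inner_le {ι : Type*} {u : ι → H} (hu : IsBessel u) {A : H →L[ℂ] H}
    (hA : A.IsPositive) :
    ∑' i, ENNReal.ofReal (inner ℂ (u i) (A (u i))).re ≤ posTrace A := by
  obtain ⟨S, hS, hSA⟩ := exists_sqrt hA
  rw [tsum_inner_eq u hS hSA, posTrace_eq_tsum_enorm hS hSA]
  exact ENNReal.tsum_le_tsum fun b => hu _

/-- The trace of a positive operator can be computed along any Parseval family; in particular it
does not depend on the basis. -/
theorem IsParseval.tsum_inner_eq {ι : Type*} {u : ι → H} (hu : IsParseval u) {A : H →L[ℂ] H}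
    (hA : A.IsPositive) :
    ∑' i, ENNReal.ofReal (inner ℂ (u i) (A (u i))).re = posTrace A := by
  obtain ⟨S, hS, hSA⟩ := exists_sqrt hA
  rw [UsNC.tsum_inner_eq u hS hSA, posTrace_eq_tsum_enorm hS hSA]
  exact tsum_congr fun b => hu _

theorem posTrace_mono {A B : H →L[ℂ] H} (h : ∀ x, (inner ℂ x (A x)).re ≤ (inner ℂ x (B x)).re) :
    posTrace A ≤ posTrace B := by
  simp only [posTrace_eq]
  exact ENNReal.tsum_le_tsum fun b => ENNReal.ofReal_le_ofReal (h _)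

theorem posTrace_sum {ι : Type*} (s : Finset ι) {A : ι → (H →L[ℂ] H)}
    (hA : ∀ i ∈ s, (A i).IsPositive) :
    posTrace (∑ i ∈ s, A i) = ∑ i ∈ s, posTrace (A i) := by
  simp only [posTrace_eq]
  rw [← Summable.tsum_finsetSum fun _ _ => ENNReal.summable]
  refine tsum_congr fun b => ?_
  rw [← ENNReal.ofReal_sum_of_nonneg fun i hi => by
    simpa using (hA i hi).re_inner_nonneg_right _]
  simp

theorem posTrace_smul {c : ℝ} (hc : 0 ≤ c) (A : H →L[ℂ] H) :
    posTrace ((c : ℂ) • A) = ENNReal.ofReal c * posTrace A := by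
  simp only [posTrace_eq]
  rw [← ENNReal.tsum_mul_left]
  refine tsum_congr fun b => ?_
  rw [← ENNReal.ofReal_mul hc]
  simp

end Bessel

/-! ### Block-diagonal operators -/

section BlockDiag

variable {H : Type*} [NormedAddCommGroup H] [InnerProductSpace ℂ H]
  {X : Type*} [Fintype X]

@[simp] theorem blockDiag_apply (T : X → (H →L[ℂ] H)) (v : CTensor X H) (x : X) :
    blockDiag T v x = T x (v x) := rfl

open Classical in
theorem inner_single_left (x : X) (h : H) (v : CTensor X H) :
    inner ℂ (PiLp.single 2 x h : CTensor X H) v = inner ℂ h (v x) := by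
  rw [PiLp.inner_apply, Finset.sum_eq_single x]
  · simp
  · intro y _ hy; simp [hy]
  · simp

open Classical in
theorem inner_single_right (x : X) (h : H) (v : CTensor X H) :
    inner ℂ v (PiLp.single 2 x h : CTensor X H) = inner ℂ (v x) h := by
  rw [← inner_conj_symm, inner_single_left, inner_conj_symm]

/-- The coordinates at `x` of a Bessel family of `ℂ^X ⊗ H` form a Bessel family of `H`. -/
theorem IsBessel.apply {ι : Type*} {u : ι → CTensor X H} (hu : IsBessel u) (x : X) :
    IsBessel (fun i => u i x) := by
  classical
  intro v
  have := hu (PiLp.single 2 x v)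
  simp only [inner_single_right] at this
  refine this.trans_eq ?_
  rw [enorm_sq_eq_ofReal, enorm_sq_eq_ofReal, PiLp.norm_single]

theorem IsParseval.apply {ι : Type*} {u : ι → CTensor X H} (hu : IsParseval u) (x : X) :
    IsParseval (fun i => u i x) := by
  classical
  intro v
  have := hu (PiLp.single 2 x v)
  simp only [inner_single_right] at this
  refine this.trans ?_
  rw [enorm_sq_eq_ofReal, enorm_sq_eq_ofReal, PiLp.norm_single]

theorem inner_blockDiag (T : X → (H →L[ℂ] H)) (v w : CTensor X H) :
    inner ℂ v (blockDiag T w) = ∑ x, inner ℂ (v x) (T x (w x)) := by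
  simp [PiLp.inner_apply]

variable [CompleteSpace H]

theorem posTrace_blockDiag {T : X → (H →L[ℂ] H)} (hT : ∀ x, (T x).IsPositive) :
    posTrace (blockDiag T) = ∑ x, posTrace (T x) := by
  have h := isParseval_hilbertBasis (traceBasis (CTensor X H))
  rw [posTrace_eq, ← Finset.sum_congr rfl fun x _ => (h.apply x).tsum_inner_eq (hT x),
    ← Summable.tsum_finsetSum fun _ _ => ENNReal.summable]
  refine tsum_congr fun b => ?_
  rw [inner_blockDiag, Complex.re_sum, ENNReal.ofReal_sum_of_nonneg fun x _ => by
    simpa using (hT x).re_inner_nonneg_right _]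

end BlockDiag

/-! ### The trace norm -/

section TraceNorm

variable {H : Type*} [NormedAddCommGroup H] [InnerProductSpace ℂ H]

theorem IsBessel.sum_le {ι : Type*} [Fintype ι] {u : ι → H} (hu : IsBessel u) (v : H) :
    ∑ i, ‖inner ℂ (u i) v‖ ^ 2 ≤ ‖v‖ ^ 2 := by
  have h := hu v
  simp only [enorm_sq_eq_ofReal, tsum_fintype] at h
  rw [← ENNReal.ofReal_sum_of_nonneg fun _ _ => by positivity] at h
  exact (ENNReal.ofReal_le_ofReal_iff (by positivity)).1 h

theorem sum_inner_le_traceNorm {ι : Type*} [Fintype ι] {e f : ι → H} (he : Orthonormal ℂ e)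
    (hf : Orthonormal ℂ f) (T : H →L[ℂ] H) :
    ∑ i, ‖inner ℂ (e i) (T (f i))‖ₑ ≤ traceNorm T := by
  let φ := (Fintype.equivFin ι).symm
  rw [← φ.sum_comp]
  unfold traceNorm
  exact le_iSup_of_le _ (le_iSup_of_le (e ∘ φ) (le_iSup_of_le (f ∘ φ)
    (le_iSup_of_le (he.comp _ φ.injective) (le_iSup_of_le (hf.comp _ φ.injective) le_rfl))))

theorem traceNorm_le {T : H →L[ℂ] H} {c : ℝ≥0∞}
    (h : ∀ (k : ℕ) (e f : Fin k → H), Orthonormal ℂ e → Orthonormal ℂ f →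
      ∑ i, ‖inner ℂ (e i) (T (f i))‖ₑ ≤ c) : traceNorm T ≤ c :=
  iSup_le fun k => iSup_le fun e => iSup_le fun f => iSup_le fun he => iSup_le fun hf =>
    h k e f he hf

theorem traceNorm_sub_le (S T : H →L[ℂ] H) : traceNorm (S - T) ≤ traceNorm S + traceNorm T := by
  refine traceNorm_le fun k e f he hf => ?_
  refine le_trans ?_ (add_le_add (sum_inner_le_traceNorm he hf S) (sum_inner_le_traceNorm he hf T))
  rw [← Finset.sum_add_distrib]
  refine Finset.sum_le_sum fun i _ => ?_
  rw [_root_.sub_apply, inner_sub_right]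
  exact enorm_sub_le

/-- The trace norm of a symmetric operator bounds its matrix elements along Bessel families, not
only along orthonormal ones: diagonalise the compression to the span of the two families. -/
theorem IsBessel.sum_inner_le_traceNorm {ι : Type*} [Fintype ι] {u v : ι → H} (hu : IsBessel u)
    (hv : IsBessel v) {T : H →L[ℂ] H} (hT : (T : H →ₗ[ℂ] H).IsSymmetric) :
    ∑ i, ‖inner ℂ (u i) (T (v i))‖ₑ ≤ traceNorm T := by
  let V : Submodule ℂ H := Submodule.span ℂ (Set.range u ∪ Set.range v)
  have : FiniteDimensional ℂ V :=
    FiniteDimensional.span_of_finite ℂ ((Set.finite_range u).union (Set.finite_range v))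
  have hu' : ∀ i, u i ∈ V := fun i => Submodule.subset_span (Or.inl ⟨i, rfl⟩)
  have hv' : ∀ i, v i ∈ V := fun i => Submodule.subset_span (Or.inr ⟨i, rfl⟩)
  -- The compression of `T` to `V`, diagonalised by `g` with eigenvalues `μ`.
  let TV : V →ₗ[ℂ] V :=
    (V.orthogonalProjectionOnto : H →ₗ[ℂ] V) ∘ₗ (T : H →ₗ[ℂ] H) ∘ₗ V.subtype
  have hTV : ∀ x y : V, inner ℂ x (TV y) = inner ℂ (x : H) (T (y : H)) := fun x y =>
    V.inner_orthogonalProjectionOnto_eq_of_mem_left x (T y)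
  have hs : TV.IsSymmetric := by
    intro x y
    rw [hTV, ← inner_conj_symm, hTV, inner_conj_symm]
    exact hT _ _
  let g := hs.eigenvectorBasis rfl
  let μ := hs.eigenvalues rfl
  have hg : ∀ j, TV (g j) = (μ j : ℂ) • g j := fun j => hs.apply_eigenvectorBasis rfl j
  have hgo : Orthonormal ℂ (fun j => (g j : H)) :=
    g.orthonormal.comp_linearIsometry V.subtypeₗᵢ
  have hμ : ∀ j, inner ℂ (g j : H) (T (g j : H)) = (μ j : ℂ) := by
    intro j
    rw [← hTV, hg, inner_smul_right, inner_self_eq_norm_sq_to_K, g.norm_eq_one]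
    simp
  have hexp : ∀ i, inner ℂ (u i) (T (v i)) =
      ∑ j, (μ j : ℂ) * (inner ℂ (u i) (g j : H) * inner ℂ (g j : H) (v i)) := by
    intro i
    have h1 := hTV ⟨u i, hu' i⟩ ⟨v i, hv' i⟩
    rw [← h1, ← g.sum_inner_mul_inner]
    refine Finset.sum_congr rfl fun j _ => ?_
    rw [← hs, hg, inner_smul_left, Complex.conj_ofReal]
    simp only [Submodule.coe_inner]
    ring
  have hcs : ∀ j, ∑ i, ‖inner ℂ (u i) (g j : H)‖ * ‖inner ℂ (g j : H) (v i)‖ ≤ 1 := by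
    intro j
    have h1 := hu.sum_le (g j : H)
    have h2 := hv.sum_le (g j : H)
    rw [show ‖(g j : H)‖ = 1 from hgo.1 j] at h1 h2
    calc _ ≤ ∑ i, (‖inner ℂ (u i) (g j : H)‖ ^ 2 + ‖inner ℂ (v i) (g j : H)‖ ^ 2) / 2 := by
          refine Finset.sum_le_sum fun i _ => ?_
          rw [norm_inner_symm (g j : H)]
          nlinarith [sq_nonneg (‖inner ℂ (u i) (g j : H)‖ - ‖inner ℂ (v i) (g j : H)‖)]
      _ ≤ 1 := by
          rw [← Finset.sum_div, Finset.sum_add_distrib]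
          linarith
  calc ∑ i, ‖inner ℂ (u i) (T (v i))‖ₑ
      = ENNReal.ofReal (∑ i, ‖inner ℂ (u i) (T (v i))‖) := by
        rw [ENNReal.ofReal_sum_of_nonneg fun _ _ => norm_nonneg _]
        simp only [ofReal_norm]
    _ ≤ ENNReal.ofReal (∑ j, |μ j|) := by
        refine ENNReal.ofReal_le_ofReal ?_
        calc _ ≤ ∑ i, ∑ j, |μ j| * (‖inner ℂ (u i) (g j : H)‖ * ‖inner ℂ (g j : H) (v i)‖) := by
              refine Finset.sum_le_sum fun i _ => ?_
              rw [hexp]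
              refine (norm_sum_le _ _).trans_eq ?_
              simp
          _ = ∑ j, |μ j| * ∑ i, ‖inner ℂ (u i) (g j : H)‖ * ‖inner ℂ (g j : H) (v i)‖ := by
              rw [Finset.sum_comm]
              simp only [Finset.mul_sum]
          _ ≤ _ := Finset.sum_le_sum fun j _ =>
              mul_le_of_le_one_right (abs_nonneg _) (hcs j)
    _ = ∑ j, ‖inner ℂ (g j : H) (T (g j : H))‖ₑ := by
        rw [ENNReal.ofReal_sum_of_nonneg fun _ _ => abs_nonneg _]
        refine Finset.sum_congr rfl fun j _ => ?_
        rw [hμ, ← ofReal_norm, Complex.norm_real, Real.norm_eq_abs]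
    _ ≤ traceNorm T := UsNC.sum_inner_le_traceNorm hgo hgo T

end TraceNorm

/-! ### Pinching -/

section Pinching

variable {H : Type*} [NormedAddCommGroup H] [InnerProductSpace ℂ H] {X : Type*} [Fintype X]

open Classical in
/-- The diagonal block at `x` of an operator on `ℂ^X ⊗ H`. -/
def diagBlock (T : CTensor X H →L[ℂ] CTensor X H) (x : X) : H →L[ℂ] H :=
  PiLp.proj 2 (fun _ : X => H) x ∘L T ∘L
    ((PiLp.continuousLinearEquiv 2 ℂ (fun _ : X => H)).symm : (X → H) →L[ℂ] CTensor X H) ∘L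
      ContinuousLinearMap.single ℂ (fun _ : X => H) x

open Classical in
theorem inner_diagBlock (T : CTensor X H →L[ℂ] CTensor X H) (x : X) (v w : H) :
    inner ℂ v (diagBlock T x w) =
      inner ℂ (PiLp.single 2 x v : CTensor X H) (T (PiLp.single 2 x w)) := by
  rw [inner_single_left]
  rfl

@[simp] theorem diagBlock_blockDiag (T : X → (H →L[ℂ] H)) (x : X) :
    diagBlock (blockDiag T) x = T x := by
  classical
  ext v
  change T x ((PiLp.single 2 x v : CTensor X H) x) = T x v
  simp

theorem diagBlock_sub (S T : CTensor X H →L[ℂ] CTensor X H) (x : X) :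
    diagBlock (S - T) x = diagBlock S x - diagBlock T x := by
  simp [diagBlock]

theorem diagBlock_isPositive {T : CTensor X H →L[ℂ] CTensor X H} (hT : T.IsPositive) (x : X) :
    (diagBlock T x).IsPositive := by
  classical
  rw [ContinuousLinearMap.isPositive_def]
  constructor
  · intro v w
    change inner ℂ (diagBlock T x v) w = inner ℂ v (diagBlock T x w)
    rw [← inner_conj_symm, inner_diagBlock, inner_conj_symm, inner_diagBlock]
    exact hT.inner_left_eq_inner_right _ _
  · intro v
    rw [ContinuousLinearMap.reApplyInnerSelf_apply, ← inner_conj_symm, inner_diagBlock,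
      RCLike.conj_re]
    exact hT.re_inner_nonneg_right _

open Classical in
theorem orthonormal_single {ι : X → Type*} {e : ∀ x, ι x → H} (he : ∀ x, Orthonormal ℂ (e x)) :
    Orthonormal ℂ (fun i : Σ x, ι x => (PiLp.single 2 i.1 (e i.1 i.2) : CTensor X H)) := by
  constructor
  · rintro ⟨x, i⟩
    simpa using (he x).1 i
  · rintro ⟨x, i⟩ ⟨y, j⟩ hij
    rw [inner_single_left]
    by_cases h : x = y
    · subst h
      simpa using (he x).2 fun h' => hij (by rw [h'])
    · simp [h]

/-- Suprema over independent parameters commute with finite sums. -/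
theorem sum_iSup_eq {α : Type*} {β : Type*} [Fintype α] [Nonempty β] (s : α → β → ℝ≥0∞) :
    ∑ a, ⨆ b, s a b = ⨆ c : α → β, ∑ a, s a (c a) := by
  classical
  rw [← ENNReal.finsetSum_iSup]
  · refine Finset.sum_congr rfl fun a _ => ?_
    exact ((Function.surjective_eval (β := fun _ : α => β) a).iSup_comp (s a)).symm
  · intro i j
    refine ⟨fun a => if s a (i a) ≤ s a (j a) then j a else i a, fun a => ?_⟩
    by_cases h : s a (i a) ≤ s a (j a)
    · simp [h]
    · simp [h, (not_le.1 h).le]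

/-- Pinching to the diagonal blocks does not increase the trace norm. -/
theorem sum_traceNorm_diagBlock_le (T : CTensor X H →L[ℂ] CTensor X H) :
    ∑ x, traceNorm (diagBlock T x) ≤ traceNorm T := by
  classical
  let Fam : Type _ := Σ k : ℕ, {p : (Fin k → H) × (Fin k → H) //
    Orthonormal ℂ p.1 ∧ Orthonormal ℂ p.2}
  have : Nonempty Fam :=
    ⟨⟨0, ⟨(Fin.elim0, Fin.elim0), by simp [Orthonormal], by simp [Orthonormal]⟩⟩⟩
  have h : ∀ x, traceNorm (diagBlock T x) ≤
      ⨆ c : Fam, ∑ i, ‖inner ℂ (c.2.1.1 i) (diagBlock T x (c.2.1.2 i))‖ₑ := fun x =>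
    traceNorm_le fun k e f he hf => le_iSup_of_le (⟨k, (e, f), he, hf⟩ : Fam) le_rfl
  refine (Finset.sum_le_sum fun x _ => h x).trans ?_
  rw [sum_iSup_eq]
  refine iSup_le fun c => ?_
  have := sum_inner_le_traceNorm (orthonormal_single fun x => (c x).2.2.1)
    (orthonormal_single fun x => (c x).2.2.2) T
  rw [Fintype.sum_sigma] at this
  simpa only [inner_diagBlock] using this

theorem sum_posTrace_diagBlock_le [CompleteSpace H] {T : CTensor X H →L[ℂ] CTensor X H}
    (hT : T.IsPositive) : ∑ x, posTrace (diagBlock T x) ≤ posTrace T := by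
  classical
  have := (orthonormal_single fun _ : X => (traceBasis H).orthonormal).isBessel.tsum_inner_le hT
  simp only [← inner_diagBlock] at this
  rw [ENNReal.tsum_sigma' , tsum_fintype] at this
  simpa only [← posTrace_eq] using this

end Pinching

/-! ### Leftover hashing against quantum side information -/

section Decoupling

variable {H : Type*} [NormedAddCommGroup H] [InnerProductSpace ℂ H]

theorem IsBessel.norm_le_one {ι : Type*} [Fintype ι] {u : ι → H} (hu : IsBessel u) (i : ι) :
    ‖u i‖ ≤ 1 := by
  have h1 := hu.sum_le (u i)
  have h2 : ‖inner ℂ (u i) (u i)‖ ^ 2 ≤ ∑ j, ‖inner ℂ (u j) (u i)‖ ^ 2 :=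
    Finset.single_le_sum (f := fun j => ‖inner ℂ (u j) (u i)‖ ^ 2) (fun _ _ => by positivity)
      (Finset.mem_univ i)
  rw [inner_self_eq_norm_sq_to_K, norm_pow, RCLike.norm_ofReal, abs_norm] at h2
  by_contra! h
  nlinarith [mul_pos (sub_pos.2 h) (sub_pos.2 h), sq_nonneg (‖u i‖ ^ 2 - 1)]

/-- If the absolute row sums of the Gram matrix `aᵀa` are at most `β`, then `‖aᵀa‖ ≤ β`, here in
a form with vector entries. -/
theorem sum_norm_sq_sum_smul_le {ι X : Type*} [Fintype ι] [Fintype X] (a : ι → X → ℝ) {β : ℝ}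
    (hβ : ∀ x, ∑ x', |∑ t, a t x * a t x'| ≤ β) (z : X → H) :
    ∑ t, ‖∑ x, (a t x : ℂ) • z x‖ ^ 2 ≤ β * ∑ x, ‖z x‖ ^ 2 := by
  have h1 : ∀ t, ‖∑ x, (a t x : ℂ) • z x‖ ^ 2 =
      ∑ x, ∑ x', a t x * a t x' * (inner ℂ (z x) (z x')).re := by
    intro t
    rw [← inner_self_eq_norm_sq (𝕜 := ℂ), sum_inner, map_sum]
    refine Finset.sum_congr rfl fun x _ => ?_
    rw [inner_sum, map_sum]
    refine Finset.sum_congr rfl fun x' _ => ?_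
    rw [inner_smul_left, inner_smul_right, Complex.conj_ofReal, ← mul_assoc, ← Complex.ofReal_mul]
    exact Complex.re_ofReal_mul _ _
  have h2 : ∀ x x', |(inner ℂ (z x) (z x')).re| ≤ (‖z x‖ ^ 2 + ‖z x'‖ ^ 2) / 2 := by
    intro x x'
    have := (Complex.abs_re_le_norm _).trans (norm_inner_le_norm (𝕜 := ℂ) (z x) (z x'))
    nlinarith [sq_nonneg (‖z x‖ - ‖z x'‖)]
  calc ∑ t, ‖∑ x, (a t x : ℂ) • z x‖ ^ 2
      = ∑ x, ∑ x', (∑ t, a t x * a t x') * (inner ℂ (z x) (z x')).re := by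
        simp only [h1, Finset.sum_mul]
        rw [Finset.sum_comm]
        exact Finset.sum_congr rfl fun x _ => Finset.sum_comm
    _ ≤ ∑ x, ∑ x', |∑ t, a t x * a t x'| * ((‖z x‖ ^ 2 + ‖z x'‖ ^ 2) / 2) := by
        refine Finset.sum_le_sum fun x _ => Finset.sum_le_sum fun x' _ => ?_
        refine (le_abs_self _).trans ?_
        rw [abs_mul]
        exact mul_le_mul_of_nonneg_left (h2 x x') (abs_nonneg _)
    _ = ∑ x, (∑ x', |∑ t, a t x * a t x'|) * ‖z x‖ ^ 2 := by
        have h3 : ∑ x, ∑ x', |∑ t, a t x * a t x'| * ‖z x'‖ ^ 2 =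
            ∑ x, ∑ x', |∑ t, a t x * a t x'| * ‖z x‖ ^ 2 := by
          rw [Finset.sum_comm]
          exact Finset.sum_congr rfl fun x _ => Finset.sum_congr rfl fun x' _ => by
            simp only [mul_comm (a _ x)]
        simp only [mul_div_assoc', mul_add, add_div, Finset.sum_add_distrib, ← Finset.sum_div, h3,
          Finset.sum_mul, add_halves]
    _ ≤ _ := by
        rw [Finset.mul_sum]
        exact Finset.sum_le_sum fun x _ => mul_le_mul_of_nonneg_right (hβ x) (by positivity)

theorem re_inner_add_smul (A : H →L[ℂ] H) (δ : ℝ) (v : H) :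
    (inner ℂ v ((A + (δ : ℂ) • ContinuousLinearMap.id ℂ H) v)).re =
      (inner ℂ v (A v)).re + δ * ‖v‖ ^ 2 := by
  change (inner ℂ v (A v + (δ : ℂ) • v)).re = _
  rw [inner_add_right, inner_smul_right, Complex.add_re, Complex.re_ofReal_mul]
  exact congrArg (fun r => _ + δ * r) (inner_self_eq_norm_sq (𝕜 := ℂ) v)

theorem isPositive_add_smul_id {A : H →L[ℂ] H} (hA : A.IsPositive) {δ : ℝ} (hδ : 0 ≤ δ) :
    (A + (δ : ℂ) • ContinuousLinearMap.id ℂ H).IsPositive := by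
  rw [ContinuousLinearMap.isPositive_def]
  constructor
  · intro v w
    change inner ℂ (A v + (δ : ℂ) • v) w = inner ℂ v (A w + (δ : ℂ) • w)
    rw [inner_add_left, inner_add_right, inner_smul_left, inner_smul_right, Complex.conj_ofReal,
      hA.inner_left_eq_inner_right]
  · intro v
    rw [ContinuousLinearMap.reApplyInnerSelf_apply, inner_re_symm]
    refine le_of_le_of_eq ?_ (re_inner_add_smul A δ v).symm
    have : 0 ≤ (inner ℂ v (A v)).re := hA.re_inner_nonneg_right v
    positivity

theorem isPositive_sandwich {T R : H →L[ℂ] H} (hT : (T : H →ₗ[ℂ] H).IsSymmetric)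
    (hR : R.IsPositive) : (T ∘L R ∘L T).IsPositive := by
  rw [ContinuousLinearMap.isPositive_def]
  constructor
  · intro v w
    change inner ℂ (T (R (T v))) w = inner ℂ v (T (R (T w)))
    have h1 : inner ℂ (T (R (T v))) w = inner ℂ (R (T v)) (T w) := hT _ _
    have h2 : inner ℂ (T v) (R (T w)) = inner ℂ v (T (R (T w))) := hT _ _
    rw [h1, ← h2, hR.inner_left_eq_inner_right]
  · intro v
    rw [ContinuousLinearMap.reApplyInnerSelf_apply]
    change 0 ≤ RCLike.re (inner ℂ (T (R (T v))) v)
    have h1 : inner ℂ (T (R (T v))) v = inner ℂ (R (T v)) (T v) := hT _ _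
    rw [h1]
    exact hR.re_inner_nonneg_left _

variable [CompleteSpace H]

/-- Cauchy–Schwarz for the form of a positive operator. -/
theorem norm_inner_le_sqrt {A : H →L[ℂ] H} (hA : A.IsPositive) (v w : H) :
    ‖inner ℂ v (A w)‖ ≤ √(inner ℂ v (A v)).re * √(inner ℂ w (A w)).re := by
  obtain ⟨S, hS, hSA⟩ := exists_sqrt hA
  have h : ∀ v, √(inner ℂ v (A v)).re = ‖S v‖ := by
    intro v
    rw [← hSA, ← hS, show (inner ℂ (S v) (S v)).re = ‖S v‖ ^ 2 from
      inner_self_eq_norm_sq (𝕜 := ℂ) _, Real.sqrt_sq (norm_nonneg _)]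
  rw [h, h, ← hSA, ← hS]
  exact norm_inner_le_norm _ _

/-- For `A` positive and `δ > 0`, the operator `A + δ` has a positive inverse. -/
theorem exists_positive_inverse {A : H →L[ℂ] H} (hA : A.IsPositive) {δ : ℝ} (hδ : 0 < δ) :
    ∃ R : H →L[ℂ] H, R.IsPositive ∧
      ∀ v, (A + (δ : ℂ) • ContinuousLinearMap.id ℂ H) (R v) = v := by
  set B : H →L[ℂ] H := A + (δ : ℂ) • ContinuousLinearMap.id ℂ H with hB
  have hBp : B.IsPositive := isPositive_add_smul_id hA hδ.le
  have hu : IsUnit B := by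
    refine ContinuousLinearMap.isUnit_of_forall_le_norm_inner_map B (c := ⟨δ, hδ.le⟩) hδ
      fun v => ?_
    rw [norm_inner_symm]
    refine le_trans ?_ (Complex.re_le_norm _)
    rw [hB, re_inner_add_smul]
    change ‖v‖ ^ 2 * δ ≤ _
    have : 0 ≤ (inner ℂ v (A v)).re := hA.re_inner_nonneg_right v
    linarith
  obtain ⟨R, hR⟩ := hu.exists_right_inv
  have hR' : ∀ v, B (R v) = v := fun v => by
    rw [← mul_apply_eq_comp, hR]; rfl
  refine ⟨R, ?_, hR'⟩
  rw [ContinuousLinearMap.isPositive_def]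
  constructor
  · intro v w
    change inner ℂ (R v) w = inner ℂ v (R w)
    conv_lhs => rw [← hR' w]
    conv_rhs => rw [← hR' v]
    exact (hBp.inner_left_eq_inner_right _ _).symm
  · intro v
    rw [ContinuousLinearMap.reApplyInnerSelf_apply]
    have := hBp.re_inner_nonneg_right (R v)
    rwa [hR' v] at this

theorem sum_re_inner_le {ι : Type*} [Fintype ι] {u : ι → H} (hu : IsBessel u) {A : H →L[ℂ] H}
    (hA : A.IsPositive) :
    ENNReal.ofReal (∑ i, (inner ℂ (u i) (A (u i))).re) ≤ posTrace A := by
  rw [ENNReal.ofReal_sum_of_nonneg fun i _ => by simpa using hA.re_inner_nonneg_right (u i),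
    ← tsum_fintype (L := .unconditional _)]
  exact hu.tsum_inner_le hA

/-- The decoupling bound with the regularised operator `τ + δ` in place of `τ`. By Cauchy–Schwarz
for the form of `τ + δ`, with inverse `R`, a matrix element of `T t = ∑ x, a t x • A x` is
controlled by `(τ + δ)` and by `T t * R * T t`. Summed over `t`, the latter is at most
`β ∑ x, A x * R * A x ≤ β q ∑ x, A x`. -/
theorem sum_inner_le_of_le_state_of_pos {ι X κ : Type*} [Fintype ι] [Fintype X] [Fintype κ]
    (a : ι → X → ℝ)
    {β q : ℝ} (hβ0 : 0 ≤ β) (hq : 0 ≤ q) (hβ : ∀ x, ∑ x', |∑ t, a t x * a t x'| ≤ β)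
    {A : X → (H →L[ℂ] H)} (hA : ∀ x, (A x).IsPositive) (hA1 : ∑ x, posTrace (A x) ≤ 1)
    {τ : H →L[ℂ] H} (hτ : IsState τ)
    (hAτ : ∀ x v, (inner ℂ v (A x v)).re ≤ q * (inner ℂ v (τ v)).re)
    {e f : ι → κ → H} (he : ∀ t, IsBessel (e t)) (hf : ∀ t, IsBessel (f t))
    {δ : ℝ} (hδ : 0 < δ) :
    ∑ t, ∑ i, ‖inner ℂ (e t i) ((∑ x, (a t x : ℂ) • A x) (f t i))‖ ≤
      √(Fintype.card ι * (1 + δ * Fintype.card κ)) * √(β * q) := by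
  obtain ⟨R, hRp, hR⟩ := exists_positive_inverse hτ.1 hδ
  set B : H →L[ℂ] H := τ + (δ : ℂ) • ContinuousLinearMap.id ℂ H with hB
  have hBR : ∀ v, B (R v) = v := hR
  have hBre : ∀ v, (inner ℂ v (B v)).re = (inner ℂ v (τ v)).re + δ * ‖v‖ ^ 2 :=
    re_inner_add_smul τ δ
  have hBp : B.IsPositive := isPositive_add_smul_id hτ.1 hδ.le
  set T : ι → (H →L[ℂ] H) := fun t => ∑ x, (a t x : ℂ) • A x with hT
  have hTs : ∀ t, ((T t : H →L[ℂ] H) : H →ₗ[ℂ] H).IsSymmetric := by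
    intro t v w
    change inner ℂ (T t v) w = inner ℂ v (T t w)
    simp only [hT, _root_.sum_apply, _root_.smul_apply, sum_inner, inner_sum, inner_smul_left,
      inner_smul_right, Complex.conj_ofReal, (hA _).inner_left_eq_inner_right]
  set N : ι → (H →L[ℂ] H) := fun t => T t ∘L R ∘L T t with hN
  have hNp : ∀ t, (N t).IsPositive := fun t => isPositive_sandwich (hTs t) hRp
  have hNv : ∀ t v, inner ℂ v (N t v) = inner ℂ (T t v) (R (T t v)) := fun t v =>
    (hTs t v (R (T t v))).symm
  have hpt : ∀ t i, ‖inner ℂ (e t i) (T t (f t i))‖ ≤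
      √(inner ℂ (e t i) (B (e t i))).re * √(inner ℂ (f t i) (N t (f t i))).re := by
    intro t i
    have h := norm_inner_le_sqrt hBp (e t i) (R (T t (f t i)))
    rwa [hBR, hRp.inner_left_eq_inner_right, ← hNv] at h
  have hB0 : ∀ v, 0 ≤ (inner ℂ v (B v)).re := fun v => hBp.re_inner_nonneg_right v
  have hN0 : ∀ t v, 0 ≤ (inner ℂ v (N t v)).re := fun t v => (hNp t).re_inner_nonneg_right v
  have hsum1 : ∑ t, ∑ i, (inner ℂ (e t i) (B (e t i))).re ≤
      Fintype.card ι * (1 + δ * Fintype.card κ) := by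
    have : ∀ t ∈ Finset.univ, ∑ i, (inner ℂ (e t i) (B (e t i))).re ≤
        1 + δ * Fintype.card κ := by
      intro t _
      simp only [hBre, Finset.sum_add_distrib, ← Finset.mul_sum]
      refine add_le_add ?_ (mul_le_mul_of_nonneg_left ?_ hδ.le)
      · have := sum_re_inner_le (he t) hτ.1
        rw [hτ.2] at this
        simpa using this
      · calc _ ≤ ∑ _i : κ, (1 : ℝ) := Finset.sum_le_sum fun i _ =>
              pow_le_one₀ (norm_nonneg _) ((he t).norm_le_one i)
          _ = _ := by simp
    refine (Finset.sum_le_sum this).trans_eq ?_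
    rw [Finset.sum_const, nsmul_eq_mul, Finset.card_univ]
  have hloew : ∀ w, (inner ℂ w ((∑ t, N t) w)).re ≤
      (inner ℂ w ((((β * q : ℝ) : ℂ) • ∑ x, A x) w)).re := by
    intro w
    obtain ⟨S, hS, hSR⟩ := exists_sqrt hRp
    have hSn : ∀ y, (inner ℂ y (R y)).re = ‖S y‖ ^ 2 := by
      intro y
      rw [← hSR, ← hS]
      exact inner_self_eq_norm_sq (𝕜 := ℂ) _
    have h1 : (inner ℂ w ((∑ t, N t) w)).re = ∑ t, ‖∑ x, (a t x : ℂ) • S (A x w)‖ ^ 2 := by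
      rw [_root_.sum_apply, inner_sum, Complex.re_sum]
      refine Finset.sum_congr rfl fun t _ => ?_
      rw [hNv, hSn]
      simp [hT]
    -- `A x * R * A x ≤ q • A x`: for `y = R (A x w)`, Cauchy–Schwarz for the form of `A x` gives
    -- `⟪y, B y⟫² ≤ ⟪y, A x y⟫ ⟪w, A x w⟫ ≤ q ⟪y, B y⟫ ⟪w, A x w⟫`.
    have h2 : ∀ x, ‖S (A x w)‖ ^ 2 ≤ q * (inner ℂ w (A x w)).re := by
      intro x
      set y := R (A x w) with hy
      have hBy : B y = A x w := hBR _
      have e1 : ‖S (A x w)‖ ^ 2 = (inner ℂ y (B y)).re := by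
        rw [hBy, ← hSn, ← hRp.inner_left_eq_inner_right]
      have h3 : (inner ℂ y (A x w)).re ≤
          √(inner ℂ y (A x y)).re * √(inner ℂ w (A x w)).re :=
        (Complex.re_le_norm _).trans (norm_inner_le_sqrt (hA x) y w)
      have h4 : (inner ℂ y (A x y)).re ≤ q * (inner ℂ y (B y)).re := by
        refine (hAτ x y).trans (mul_le_mul_of_nonneg_left ?_ hq)
        rw [hBre]
        nlinarith [sq_nonneg ‖y‖]
      have hw0 : 0 ≤ (inner ℂ w (A x w)).re := (hA x).re_inner_nonneg_right w
      have hy0 : 0 ≤ (inner ℂ y (A x y)).re := (hA x).re_inner_nonneg_right y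
      have hb0 := hB0 y
      rw [← hBy] at h3
      rw [e1]
      rw [← Real.sqrt_mul hy0] at h3
      have h5 := pow_le_pow_left₀ hb0 h3 2
      rw [Real.sq_sqrt (mul_nonneg hy0 (by rwa [hBy]))] at h5
      rw [hBy] at h5 h4 hb0 ⊢
      rcases hb0.eq_or_lt with h0 | h0
      · rw [← h0]; positivity
      · have h6 := mul_le_mul_of_nonneg_right h4 hw0
        nlinarith
    rw [h1]
    refine (sum_norm_sq_sum_smul_le a hβ fun x => S (A x w)).trans ?_
    have h7 := mul_le_mul_of_nonneg_left (Finset.sum_le_sum fun x (_ : x ∈ Finset.univ) => h2 x) hβ0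
    refine h7.trans_eq ?_
    rw [_root_.smul_apply, inner_smul_right, _root_.sum_apply, inner_sum, Complex.re_ofReal_mul,
      Complex.re_sum, ← Finset.mul_sum, mul_assoc]
  have hsum2 : ∑ t, ∑ i, (inner ℂ (f t i) (N t (f t i))).re ≤ β * q := by
    rw [← ENNReal.ofReal_le_ofReal_iff (by positivity),
      ENNReal.ofReal_sum_of_nonneg fun t _ => Finset.sum_nonneg fun i _ => hN0 t _]
    calc _ ≤ ∑ t, posTrace (N t) := Finset.sum_le_sum fun t _ => sum_re_inner_le (hf t) (hNp t)
      _ = posTrace (∑ t, N t) := (posTrace_sum _ fun t _ => hNp t).symm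
      _ ≤ posTrace (((β * q : ℝ) : ℂ) • ∑ x, A x) := posTrace_mono hloew
      _ = ENNReal.ofReal (β * q) * ∑ x, posTrace (A x) := by
        rw [posTrace_smul (by positivity), posTrace_sum _ fun x _ => hA x]
      _ ≤ _ := mul_le_of_le_one_right' hA1
  calc _ ≤ ∑ t, ∑ i, √(inner ℂ (e t i) (B (e t i))).re * √(inner ℂ (f t i) (N t (f t i))).re :=
        Finset.sum_le_sum fun t _ => Finset.sum_le_sum fun i _ => hpt t i
    _ ≤ √(∑ t, ∑ i, (inner ℂ (e t i) (B (e t i))).re) *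
        √(∑ t, ∑ i, (inner ℂ (f t i) (N t (f t i))).re) := by
        simp only [← Fintype.sum_prod_type']
        exact Real.sum_sqrt_mul_sqrt_le _ (fun _ => hB0 _) (fun _ => hN0 _ _)
    _ ≤ _ := mul_le_mul (Real.sqrt_le_sqrt hsum1) (Real.sqrt_le_sqrt hsum2)
        (Real.sqrt_nonneg _) (Real.sqrt_nonneg _)

/-- The decoupling bound: the limit `δ → 0` of `sum_inner_le_of_le_state_of_pos`. The families `e t`
and `f t` are allowed to be Bessel, as the coordinates of orthonormal families of `ℂ^ι ⊗ H` are. -/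
theorem sum_inner_le_of_le_state {ι X κ : Type*} [Fintype ι] [Fintype X] [Fintype κ]
    (a : ι → X → ℝ)
    {β q : ℝ} (hβ0 : 0 ≤ β) (hq : 0 ≤ q) (hβ : ∀ x, ∑ x', |∑ t, a t x * a t x'| ≤ β)
    {A : X → (H →L[ℂ] H)} (hA : ∀ x, (A x).IsPositive) (hA1 : ∑ x, posTrace (A x) ≤ 1)
    {τ : H →L[ℂ] H} (hτ : IsState τ)
    (hAτ : ∀ x v, (inner ℂ v (A x v)).re ≤ q * (inner ℂ v (τ v)).re)
    {e f : ι → κ → H} (he : ∀ t, IsBessel (e t)) (hf : ∀ t, IsBessel (f t)) :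
    ∑ t, ∑ i, ‖inner ℂ (e t i) ((∑ x, (a t x : ℂ) • A x) (f t i))‖ ≤
      √(Fintype.card ι * (β * q)) := by
  have hlim : Filter.Tendsto
      (fun δ : ℝ => √(Fintype.card ι * (1 + δ * Fintype.card κ)) * √(β * q))
      (nhdsWithin 0 (Set.Ioi 0)) (nhds (√(Fintype.card ι * (1 + 0 * Fintype.card κ)) * √(β * q))) :=
    (Continuous.tendsto (by fun_prop) 0).mono_left nhdsWithin_le_nhds
  rw [Real.sqrt_mul (by positivity)]
  rw [zero_mul, add_zero, mul_one] at hlim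
  refine ge_of_tendsto hlim ?_
  filter_upwards [self_mem_nhdsWithin] with δ hδ
  exact sum_inner_le_of_le_state_of_pos a hβ0 hq hβ hA hA1 hτ hAτ he hf hδ

/-- The leftover hashing bound against smooth quantum side information. For
`T t = ∑ x, a t x • ρ x`, where the positive operators `A x` are close to the `ρ x` and
satisfy `A x ≤ q • τ` for a state `τ`, the operator `∑ t, |t⟩⟨t| ⊗ T t` has trace norm at most
`√(|ι| β q)` plus `α` times the distance. -/
theorem traceNorm_blockDiag_sum_smul_le {ι X : Type*} [Fintype ι] [Fintype X] (a : ι → X → ℝ)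
    {α β q : ℝ} (hβ0 : 0 ≤ β) (hq : 0 ≤ q)
    (hα : ∀ x, ∑ t, |a t x| ≤ α) (hβ : ∀ x, ∑ x', |∑ t, a t x * a t x'| ≤ β)
    {ρ A : X → (H →L[ℂ] H)} (hρ : ∀ x, (ρ x).IsPositive)
    (hA : ∀ x, (A x).IsPositive) (hA1 : ∑ x, posTrace (A x) ≤ 1)
    {τ : H →L[ℂ] H} (hτ : IsState τ)
    (hAτ : ∀ x v, (inner ℂ v (A x v)).re ≤ q * (inner ℂ v (τ v)).re) :
    traceNorm (blockDiag fun t => ∑ x, (a t x : ℂ) • ρ x) ≤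
      ENNReal.ofReal √(Fintype.card ι * (β * q)) +
        ENNReal.ofReal α * ∑ x, traceNorm (A x - ρ x) := by
  refine traceNorm_le fun k e f he hf => ?_
  have he' : ∀ t, IsBessel fun i => e i t := fun t => he.isBessel.apply t
  have hf' : ∀ t, IsBessel fun i => f i t := fun t => hf.isBessel.apply t
  have hsym : ∀ x, ((A x - ρ x : H →L[ℂ] H) : H →ₗ[ℂ] H).IsSymmetric := by
    intro x v w
    change inner ℂ (A x v - ρ x v) w = inner ℂ v (A x w - ρ x w)
    rw [inner_sub_left, inner_sub_right, (hA x).inner_left_eq_inner_right,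
      (hρ x).inner_left_eq_inner_right]
  have hsplit : ∀ t v w, ‖inner ℂ v ((∑ x, (a t x : ℂ) • ρ x) w)‖ₑ ≤
      ‖inner ℂ v ((∑ x, (a t x : ℂ) • A x) w)‖ₑ +
        ∑ x, ‖a t x‖ₑ * ‖inner ℂ v ((A x - ρ x) w)‖ₑ := by
    intro t v w
    have : inner ℂ v ((∑ x, (a t x : ℂ) • ρ x) w) = inner ℂ v ((∑ x, (a t x : ℂ) • A x) w) -
        ∑ x, (a t x : ℂ) * inner ℂ v ((A x - ρ x) w) := by
      simp only [_root_.sum_apply, _root_.smul_apply, _root_.sub_apply, inner_sum,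
        inner_smul_right, inner_sub_right, mul_sub, Finset.sum_sub_distrib]
      ring
    rw [this]
    refine enorm_sub_le.trans (add_le_add le_rfl ((enorm_sum_le _ _).trans_eq ?_))
    refine Finset.sum_congr rfl fun x _ => ?_
    rw [enorm_mul]
    congr 1
    rw [← ofReal_norm, Complex.norm_real, ofReal_norm]
  calc ∑ i, ‖inner ℂ (e i) (blockDiag (fun t => ∑ x, (a t x : ℂ) • ρ x) (f i))‖ₑ
      ≤ ∑ i, ∑ t, ‖inner ℂ (e i t) ((∑ x, (a t x : ℂ) • ρ x) (f i t))‖ₑ := by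
        refine Finset.sum_le_sum fun i _ => ?_
        rw [inner_blockDiag]
        exact enorm_sum_le _ _
    _ ≤ ∑ i, ∑ t, (‖inner ℂ (e i t) ((∑ x, (a t x : ℂ) • A x) (f i t))‖ₑ +
        ∑ x, ‖a t x‖ₑ * ‖inner ℂ (e i t) ((A x - ρ x) (f i t))‖ₑ) :=
        Finset.sum_le_sum fun i _ => Finset.sum_le_sum fun t _ => hsplit t _ _
    _ = ∑ t, ∑ i, ‖inner ℂ (e i t) ((∑ x, (a t x : ℂ) • A x) (f i t))‖ₑ +
        ∑ x, ∑ t, ‖a t x‖ₑ * ∑ i, ‖inner ℂ (e i t) ((A x - ρ x) (f i t))‖ₑ := by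
        simp only [Finset.sum_add_distrib, Finset.mul_sum]
        congr 1
        · exact Finset.sum_comm
        · rw [Finset.sum_comm]
          exact (Finset.sum_congr rfl fun t _ => Finset.sum_comm).trans Finset.sum_comm
    _ ≤ _ := by
        refine add_le_add ?_ ?_
        · have := sum_inner_le_of_le_state a hβ0 hq hβ hA hA1 hτ hAτ he' hf'
          simp only [← ofReal_norm]
          rw [← Finset.sum_congr rfl fun t _ =>
              ENNReal.ofReal_sum_of_nonneg fun i _ => norm_nonneg _,
            ← ENNReal.ofReal_sum_of_nonneg fun t _ => Finset.sum_nonneg fun i _ => norm_nonneg _]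
          exact ENNReal.ofReal_le_ofReal this
        · rw [Finset.mul_sum]
          refine Finset.sum_le_sum fun x _ => ?_
          calc _ ≤ ∑ t, ‖a t x‖ₑ * traceNorm (A x - ρ x) :=
                Finset.sum_le_sum fun t _ => mul_le_mul_right
                  ((he' t).sum_inner_le_traceNorm (hf' t) (hsym x)) _
            _ ≤ _ := by
                rw [← Finset.sum_mul]
                refine mul_le_mul_left ?_ _
                simp only [← ofReal_norm, Real.norm_eq_abs]
                rw [← ENNReal.ofReal_sum_of_nonneg fun _ _ => abs_nonneg _]
                exact ENNReal.ofReal_le_ofReal (hα x)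

end Decoupling

/-! ### Collision probabilities of balanced hash families -/

section Collision

variable {S D M : Type*} [Fintype S] [Fintype M]

open Classical in
/-- The covariance of two hash values: the collision probability of `c` and `c'` minus its value
`1 / |M|` for independent uniform hash values. -/
def BalancedUHF.excess (F : BalancedUHF S D M) (c c' : D) : ℝ :=
  (∑ s, ((if F.f s c = F.f s c' then 1 else 0) - 1 / (Fintype.card M : ℝ))) / Fintype.card S

open Classical in
theorem BalancedUHF.excess_eq [Nonempty S] (F : BalancedUHF S D M) (c c' : D) :
    F.excess c c' = (Nat.card {s // F.f s c = F.f s c'} : ℝ) / Nat.card S - 1 / Nat.card M := by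
  have hS : (Fintype.card S : ℝ) ≠ 0 := by simp
  rw [BalancedUHF.excess, Finset.sum_sub_distrib, Finset.sum_boole, sub_div, Finset.sum_const,
    nsmul_eq_mul, Finset.card_univ, mul_div_cancel_left₀ _ hS, Nat.card_eq_fintype_card,
    Fintype.card_subtype, Nat.card_eq_fintype_card, Nat.card_eq_fintype_card]

theorem BalancedUHF.excess_self_le [Nonempty S] (F : BalancedUHF S D M) (c : D) :
    F.excess c c ≤ 1 := by
  classical
  have hS : (Fintype.card S : ℝ) ≠ 0 := by simp
  rw [BalancedUHF.excess]
  simp only [if_true, Finset.sum_const, nsmul_eq_mul, Finset.card_univ]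
  rw [mul_div_cancel_left₀ _ hS]
  have : 0 ≤ 1 / (Fintype.card M : ℝ) := by positivity
  linarith

open Classical in
/-- Balancedness: averaged over the second argument, the collision probability is exactly
`1 / |M|`. -/
theorem BalancedUHF.sum_excess [Fintype D] (F : BalancedUHF S D M) (c : D) :
    ∑ c', F.excess c c' = 0 := by
  simp only [BalancedUHF.excess]
  rw [← Finset.sum_div, Finset.sum_comm, Finset.sum_eq_zero, zero_div]
  intro s _
  have h := F.card_eq s (F.f s c)
  rw [Nat.card_eq_fintype_card, Fintype.card_subtype] at h
  have hM : (Fintype.card M : ℝ) ≠ 0 := by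
    have : Nonempty M := ⟨F.f s c⟩
    simp
  rw [Finset.sum_sub_distrib, Finset.sum_boole, Finset.sum_const, nsmul_eq_mul, Finset.card_univ, h]
  push_cast
  simp only [eq_comm (a := F.f s c)]
  field_simp
  ring

/-- The excess is nonpositive off the diagonal (universality) and has vanishing row sums
(balancedness), so the absolute row sums are at most twice the diagonal entry. -/
theorem BalancedUHF.sum_abs_excess_le [Nonempty S] [Fintype D] (F : BalancedUHF S D M) (c : D) :
    ∑ c', |F.excess c c'| ≤ 2 := by
  classical
  have h0 := F.sum_excess c
  have h1 := F.excess_self_le c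
  rw [← Finset.add_sum_erase _ _ (Finset.mem_univ c)] at h0 ⊢
  have h2 : ∑ c' ∈ Finset.univ.erase c, |F.excess c c'| =
      -∑ c' ∈ Finset.univ.erase c, F.excess c c' := by
    rw [← Finset.sum_neg_distrib]
    refine Finset.sum_congr rfl fun c' hc' => abs_of_nonpos ?_
    rw [F.excess_eq, sub_nonpos]
    exact F.universal c c' (Finset.ne_of_mem_erase hc').symm
  have hn : 0 ≤ F.excess c c := by
    have : ∑ c' ∈ Finset.univ.erase c, |F.excess c c'| ≥ 0 :=
      Finset.sum_nonneg fun _ _ => abs_nonneg _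
    linarith
  rw [h2, abs_of_nonneg hn]
  linarith

end Collision

/-! ### The commit phase as a combination of channel outputs -/

section Coefficients

variable {n : ℕ} {C : Code n} {rep : Coset C → Word n}

/-- The codeword of which `x` is the shift by a coset representative. -/
def codeword (hrep : ∀ q, Submodule.Quotient.mk (rep q) = q) (x : Word n) : C :=
  ⟨x - rep (Submodule.Quotient.mk x), by
    rw [← Submodule.Quotient.mk_eq_zero, Submodule.Quotient.mk_sub, hrep, sub_self]⟩

/-- Every word is uniquely the sum of a codeword and a coset representative. -/
def wordEquiv (hrep : ∀ q, Submodule.Quotient.mk (rep q) = q) : Word n ≃ Coset C × C where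
  toFun x := (Submodule.Quotient.mk x, codeword hrep x)
  invFun y := y.2 + rep y.1
  left_inv x := by simp [codeword]
  right_inv y := by
    have h : (Submodule.Quotient.mk ((y.2 : Word n) + rep y.1) : Coset C) = y.1 := by
      rw [Submodule.Quotient.mk_add, hrep, (Submodule.Quotient.mk_eq_zero C).2 y.2.2, zero_add]
    ext1
    · exact h
    · ext1
      simp [codeword, h]

theorem card_coset_mul_card (C : Code n) : Fintype.card (Coset C) * Fintype.card C = 2 ^ n := by
  have h := Submodule.card_eq_card_quotient_mul_card C
  rw [Nat.card_eq_fintype_card, Nat.card_eq_fintype_card, Nat.card_eq_fintype_card] at h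
  rw [mul_comm, ← h]
  simp [ZMod.card]

variable {M : Type*} {S : Type*} [AddGroup M] [Fintype M] [Fintype S] [Nonempty S]

theorem protocol_commit (θ : Params) (ε : ℝ) (F : BalancedUHF S C M) (m : M) :
    (protocol θ ε C rep F).commit m =
      (PMF.uniformOfFintype S).bind fun s => (PMF.uniformOfFintype M).bind fun k =>
        (PMF.uniformOfFintype (Coset C)).bind fun q =>
          (F.invMap s (m + k)).map
            fun c : C => ((c : Word n) + rep q, (s, k, q), (c : Word n)) := by
  -- `protocol` draws from the law of the codeword as a word: it pushes `Γ_s` forward to words.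
  have h : ∀ (s : S) (k : M) (q : Coset C),
      (F.invMap s (m + k)).map (fun c : C => ((c : Word n) + rep q, (s, k, q), (c : Word n))) =
        ((F.invMap s (m + k)).bind fun c => PMF.pure (c : Word n)).map
          fun c => (c + rep q, (s, k, q), c) := by
    intro s k q
    rw [show ((F.invMap s (m + k)).bind fun c => PMF.pure (c : Word n)) =
      (F.invMap s (m + k)).map Subtype.val from PMF.bind_pure_comp _ _, PMF.map_comp]
    rfl
  simp only [h]
  rfl

open Classical in
/-- The input `x` and the noiseless message `(s, k, q)` are uniform on the pairs for which `x` lies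
in the coset `q` and the codeword of `x` has hash value `m + k`. -/
theorem commit_apply (hrep : ∀ q, Submodule.Quotient.mk (rep q) = q) (θ : Params) (ε : ℝ)
    (F : BalancedUHF S C M) (m : M) (x : Word n) (s : S) (k : M) (q : Coset C) :
    (((protocol θ ε C rep F).commit m).map fun w => (w.1, w.2.1)) (x, (s, k, q)) =
      if Submodule.Quotient.mk x = q ∧ F.f s (codeword hrep x) = m + k then
        ((Fintype.card S : ℝ≥0∞) * 2 ^ n)⁻¹ else 0 := by
  have hval : (Fintype.card S : ℝ≥0∞)⁻¹ * ((Fintype.card M : ℝ≥0∞)⁻¹ *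
      ((Fintype.card (Coset C) : ℝ≥0∞)⁻¹ * ((Fintype.card M : ℝ≥0∞) / Fintype.card C))) =
        ((Fintype.card S : ℝ≥0∞) * 2 ^ n)⁻¹ := by
    have h1 : (2 : ℝ≥0∞) ^ n = Fintype.card (Coset C) * Fintype.card C := by
      rw [← Nat.cast_mul, card_coset_mul_card]; simp
    have hM : (Fintype.card M : ℝ≥0∞) ≠ 0 := by simp
    rw [h1, ENNReal.mul_inv (by simp) (by simp),
      ENNReal.mul_inv (by simp) (by simp), div_eq_mul_inv]
    congr 1
    rw [mul_left_comm, mul_left_comm (Fintype.card M : ℝ≥0∞)⁻¹,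
      ← mul_assoc (Fintype.card M : ℝ≥0∞), ENNReal.mul_inv_cancel hM (by simp), one_mul]
  have hinner : ∀ s' k' q', ((F.invMap s' (m + k')).map
      ((fun w : Word n × (S × M × Coset C) × Word n => (w.1, w.2.1)) ∘
        fun c : C => ((c : Word n) + rep q', (s', k', q'), (c : Word n)))) (x, (s, k, q)) =
      if (s' = s ∧ k' = k) ∧ q' = q then
        (if Submodule.Quotient.mk x = q ∧ F.f s (codeword hrep x) = m + k then
          (Fintype.card M : ℝ≥0∞) / Fintype.card C else 0) else 0 := by
    intro s' k' q'
    rw [PMF.map_apply, tsum_fintype]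
    by_cases h : (s' = s ∧ k' = k) ∧ q' = q
    · obtain ⟨⟨rfl, rfl⟩, rfl⟩ := h
      simp only [Function.comp, Prod.mk.injEq, and_true, if_true]
      have hiff : ∀ c : C, x = (c : Word n) + rep q' ↔
          (q', c) = ((Submodule.Quotient.mk x : Coset C), codeword hrep x) := fun c => by
        rw [eq_comm]
        exact ((wordEquiv hrep).symm_apply_eq (x := (q', c)) (y := x)).trans Iff.rfl
      simp only [hiff, Prod.mk.injEq]
      by_cases hq : q' = Submodule.Quotient.mk x
      · simp [← hq, BalancedUHF.invMap]
      · simp [hq, Ne.symm hq]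
    · rw [if_neg h]
      refine Finset.sum_eq_zero fun c _ => if_neg fun h' => h ?_
      simp only [Function.comp, Prod.mk.injEq] at h'
      exact ⟨⟨h'.2.1.symm, h'.2.2.1.symm⟩, h'.2.2.2.symm⟩
  simp only [protocol_commit, PMF.map_bind, PMF.map_comp, PMF.bind_apply, tsum_fintype,
    PMF.uniformOfFintype_apply, hinner]
  rw [Finset.sum_eq_single s (by intro s' _ hs; simp [hs]) (by simp),
    Finset.sum_eq_single k (by intro k' _ hk; simp [hk]) (by simp),
    Finset.sum_eq_single q (by intro q' _ hq; simp [hq]) (by simp)]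
  by_cases h : Submodule.Quotient.mk x = q ∧ F.f s (codeword hrep x) = m + k
  · simp only [h, and_self, if_true]
    exact hval
  · simp [h]

open Classical in
/-- The coefficients of Bob's state for message `m` relative to his state for a uniformly random
hash value, as a combination of the subnormalised outputs `2⁻ⁿ W x`. -/
def hashCoeff (hrep : ∀ q, Submodule.Quotient.mk (rep q) = q) (F : BalancedUHF S C M) (m : M)
    (t : S × M × Coset C) (x : Word n) : ℝ :=
  if Submodule.Quotient.mk x = t.2.2 then
    ((if F.f t.1 (codeword hrep x) = m + t.2.1 then 1 else 0) - 1 / (Fintype.card M : ℝ)) /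
      Fintype.card S else 0

open Classical in
/-- The state for a uniformly random hash value cancels in the difference of Bob's states for two
messages. -/
theorem commit_toReal_sub (hrep : ∀ q, Submodule.Quotient.mk (rep q) = q) (θ : Params) (ε : ℝ)
    (F : BalancedUHF S C M) (m m' : M) (x : Word n) (t : S × M × Coset C) :
    ((((protocol θ ε C rep F).commit m).map fun w => (w.1, w.2.1)) (x, t)).toReal -
      ((((protocol θ ε C rep F).commit m').map fun w => (w.1, w.2.1)) (x, t)).toReal =
    (hashCoeff hrep F m t x - hashCoeff hrep F m' t x) * (2 ^ n)⁻¹ := by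
  obtain ⟨s, k, q⟩ := t
  rw [commit_apply hrep, commit_apply hrep, hashCoeff, hashCoeff]
  by_cases hq : Submodule.Quotient.mk x = q
  · simp only [hq, true_and, if_true]
    split_ifs <;> simp <;> ring
  · simp [hq]

theorem sum_abs_hashCoeff_le (hrep : ∀ q, Submodule.Quotient.mk (rep q) = q)
    (F : BalancedUHF S C M) (m : M) (x : Word n) : ∑ t, |hashCoeff hrep F m t x| ≤ 2 := by
  classical
  have hS : (Fintype.card S : ℝ) ≠ 0 := by simp
  have hM : (Fintype.card M : ℝ) ≠ 0 := by simp
  simp only [Fintype.sum_prod_type, hashCoeff]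
  calc _ = ∑ s : S, ∑ k : M, |((if F.f s (codeword hrep x) = m + k then 1 else 0) -
        1 / (Fintype.card M : ℝ)) / Fintype.card S| := by
        refine Finset.sum_congr rfl fun s _ => Finset.sum_congr rfl fun k _ => ?_
        rw [Finset.sum_eq_single (Submodule.Quotient.mk x)]
        · simp
        · intro q _ hq; simp [hq.symm]
        · simp
    _ ≤ ∑ s : S, ∑ k : M, ((if k = -m + F.f s (codeword hrep x) then 1 else 0) +
        1 / (Fintype.card M : ℝ)) / Fintype.card S := by
        refine Finset.sum_le_sum fun s _ => Finset.sum_le_sum fun k _ => ?_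
        rw [abs_div, Nat.abs_cast]
        refine div_le_div_of_nonneg_right ?_ (by positivity)
        have hk : k = -m + F.f s (codeword hrep x) ↔ F.f s (codeword hrep x) = m + k := by
          rw [eq_neg_add_iff_add_eq, eq_comm]
        refine (abs_sub _ _).trans ?_
        simp only [hk]
        split_ifs <;> simp
    _ = 2 := by
        simp only [← Finset.sum_div, Finset.sum_add_distrib, Finset.sum_ite_eq', Finset.mem_univ,
          if_true, Finset.sum_const, nsmul_eq_mul, Finset.card_univ]
        field_simp
        norm_num

open Classical in
theorem sum_hashCoeff_mul (hrep : ∀ q, Submodule.Quotient.mk (rep q) = q)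
    (F : BalancedUHF S C M) (m : M) (x x' : Word n) :
    ∑ t, hashCoeff hrep F m t x * hashCoeff hrep F m t x' =
      if (Submodule.Quotient.mk x : Coset C) = Submodule.Quotient.mk x' then
        F.excess (codeword hrep x) (codeword hrep x') / Fintype.card S else 0 := by
  have hS : (Fintype.card S : ℝ) ≠ 0 := by simp
  have hM : (Fintype.card M : ℝ) ≠ 0 := by simp
  simp only [Fintype.sum_prod_type, hashCoeff]
  by_cases h : (Submodule.Quotient.mk x : Coset C) = Submodule.Quotient.mk x'
  · rw [if_pos h, BalancedUHF.excess, Finset.sum_div, Finset.sum_div]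
    refine Finset.sum_congr rfl fun s _ => ?_
    have hk : ∀ (y : M) (k : M), y = m + k ↔ k = -m + y := fun y k => by
      rw [eq_neg_add_iff_add_eq, eq_comm]
    calc _ = ∑ k : M, ((if k = -m + F.f s (codeword hrep x) then 1 else 0) -
          1 / (Fintype.card M : ℝ)) * ((if k = -m + F.f s (codeword hrep x') then 1 else 0) -
          1 / (Fintype.card M : ℝ)) / (Fintype.card S * Fintype.card S) := by
          refine Finset.sum_congr rfl fun k _ => ?_
          rw [Finset.sum_eq_single (Submodule.Quotient.mk x)]
          · simp only [if_true, ← h, hk]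
            rw [div_mul_div_comm]
          · intro q _ hq; simp [hq.symm]
          · simp
      _ = _ := by
          rw [← Finset.sum_div, div_div]
          congr 1
          simp only [sub_mul, mul_sub, Finset.sum_sub_distrib, ← Finset.mul_sum,
            ite_mul, one_mul, zero_mul, Finset.sum_ite_eq', Finset.mem_univ, if_true,
            Finset.sum_const, nsmul_eq_mul, Finset.card_univ, add_right_inj]
          field_simp
          ring
  · rw [if_neg h]
    refine Finset.sum_eq_zero fun s _ => Finset.sum_eq_zero fun k _ => Finset.sum_eq_zero
      fun q _ => ?_
    by_cases hq : Submodule.Quotient.mk x = q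
    · subst hq
      simp [Ne.symm h]
    · simp [hq]

theorem sum_abs_sum_hashCoeff_mul_le (hrep : ∀ q, Submodule.Quotient.mk (rep q) = q)
    (F : BalancedUHF S C M) (m : M) (x : Word n) :
    ∑ x', |∑ t, hashCoeff hrep F m t x * hashCoeff hrep F m t x'| ≤ 2 / Fintype.card S := by
  classical
  simp only [sum_hashCoeff_mul]
  calc _ = ∑ y : Coset C × C, |if (Submodule.Quotient.mk x : Coset C) = y.1 then
        F.excess (codeword hrep x) y.2 / Fintype.card S else 0| :=
        (wordEquiv hrep).sum_comp (fun y => |if (Submodule.Quotient.mk x : Coset C) = y.1 then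
          F.excess (codeword hrep x) y.2 / Fintype.card S else 0|)
    _ = ∑ c : C, |F.excess (codeword hrep x) c| / Fintype.card S := by
        rw [Fintype.sum_prod_type, Finset.sum_eq_single (Submodule.Quotient.mk x)]
        · simp only [if_true, abs_div, Nat.abs_cast]
        · intro q _ hq; simp [hq.symm]
        · simp
    _ ≤ 2 / Fintype.card S := by
        rw [← Finset.sum_div]
        exact div_le_div_of_nonneg_right (F.sum_abs_excess_le _) (by positivity)

end Coefficients

/-! ### Hiding -/

section Hiding

variable {n : ℕ} {C : Code n} {rep : Coset C → Word n}
  {H : Type*} [NormedAddCommGroup H] [InnerProductSpace ℂ H]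

theorem isPositive_ofReal_smul {A : H →L[ℂ] H} (hA : A.IsPositive) {c : ℝ} (hc : 0 ≤ c) :
    ((c : ℂ) • A).IsPositive :=
  hA.smul_of_nonneg (by exact_mod_cast hc)

variable [CompleteSpace H]

theorem posTrace_bobState {M T R A : Type*} [Fintype T] (Φ : Protocol n M T R A)
    {W : Word n → (H →L[ℂ] H)} (hW : ∀ x, IsState (W x)) (m : M) :
    posTrace (bobState Φ W m) = 1 := by
  have hp : ∀ t x, (((((((Φ.commit m).map fun w => (w.1, w.2.1)) (x, t)).toReal : ℝ) : ℂ)) •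
      W x).IsPositive := fun t x => isPositive_ofReal_smul (hW x).1 ENNReal.toReal_nonneg
  rw [bobState, posTrace_blockDiag fun t => ContinuousLinearMap.isPositive_sum _ fun x _ => hp t x]
  have h1 : ∀ t, posTrace (∑ x, (((((Φ.commit m).map fun w => (w.1, w.2.1)) (x, t)).toReal : ℝ) : ℂ)
      • W x) = ∑ x, ((Φ.commit m).map fun w => (w.1, w.2.1)) (x, t) := by
    intro t
    rw [posTrace_sum _ fun x _ => hp t x]
    refine Finset.sum_congr rfl fun x _ => ?_
    rw [posTrace_smul ENNReal.toReal_nonneg, (hW x).2, mul_one,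
      ENNReal.ofReal_toReal (PMF.apply_ne_top _ _)]
  rw [Finset.sum_congr rfl fun t _ => h1 t, Finset.sum_comm, ← Fintype.sum_prod_type',
    ← tsum_fintype (L := .unconditional _)]
  exact PMF.tsum_coe _

/-- Unpacking of the smooth min-entropy: some positive operators `A x` of total trace at most `1`
lie below a small multiple of a common state and are close to the operators `ρ x`. The smoothing
state need not be block diagonal; pinching it provides the `A x`. -/
theorem exists_le_state_of_lt_smoothCondMinEntropy {X : Type*} [Fintype X] {ε l : ℝ}
    {ρ : X → (H →L[ℂ] H)} (h : (l : EReal) < smoothCondMinEntropy ε (blockDiag ρ)) :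
    ∃ (A : X → (H →L[ℂ] H)) (τ : H →L[ℂ] H), (∀ x, (A x).IsPositive) ∧
      ∑ x, posTrace (A x) ≤ 1 ∧ IsState τ ∧
      (∀ x v, (inner ℂ v (A x v)).re ≤ 2 ^ (-l) * (inner ℂ v (τ v)).re) ∧
      ∑ x, traceNorm (A x - ρ x) ≤ 2 * ENNReal.ofReal ε := by
  classical
  simp only [smoothCondMinEntropy, condMinEntropy, lt_iSup_iff] at h
  obtain ⟨ρ', hρ', hd, τ, hτ, h⟩ := h
  rw [EReal.lt_neg_comm, maxDiv] at h
  simp only [iInf_lt_iff] at h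
  obtain ⟨r, hle, hr⟩ := h
  have hr' : r < -l := by exact_mod_cast hr
  refine ⟨diagBlock ρ', τ, diagBlock_isPositive hρ'.1,
    (sum_posTrace_diagBlock_le hρ'.1).trans hρ'.2, hτ, fun x v => ?_, ?_⟩
  · have h1 := (ContinuousLinearMap.le_def _ _).1 hle |>.re_inner_nonneg_right
      (PiLp.single 2 x v : CTensor X H)
    rw [_root_.sub_apply, _root_.smul_apply, inner_sub_right, inner_smul_right, ← inner_diagBlock,
      ← inner_diagBlock, diagBlock_blockDiag, map_sub, sub_nonneg] at h1
    have h2 : (inner ℂ v (diagBlock ρ' x v)).re ≤ 2 ^ r * (inner ℂ v (τ v)).re :=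
      h1.trans_eq (Complex.re_ofReal_mul _ _)
    refine h2.trans (mul_le_mul_of_nonneg_right ?_ (hτ.1.re_inner_nonneg_right v))
    exact Real.rpow_le_rpow_of_exponent_le one_le_two hr'.le
  · have h1 := sum_traceNorm_diagBlock_le (ρ' - blockDiag ρ)
    simp only [diagBlock_sub, diagBlock_blockDiag] at h1
    refine h1.trans ?_
    have h2 : 2⁻¹ * traceNorm (ρ' - blockDiag ρ) ≤ ENNReal.ofReal ε := le_self_add.trans hd
    calc _ = 2 * (2⁻¹ * traceNorm (ρ' - blockDiag ρ)) := by
          rw [← mul_assoc, ENNReal.mul_inv_cancel two_ne_zero ENNReal.ofNat_ne_top, one_mul]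
      _ ≤ _ := mul_le_mul_right h2 _

variable {M : Type*} {S : Type*} [AddGroup M] [Fintype M] [Fintype S] [Nonempty S]

theorem gtd_bobState_le (hrep : ∀ q, Submodule.Quotient.mk (rep q) = q) (θ : Params) (ε : ℝ)
    (F : BalancedUHF S C M) {W : Word n → (H →L[ℂ] H)} (hW : IsBobChannel θ W) (m m' : M) :
    gtd (bobState (protocol θ ε C rep F) W m) (bobState (protocol θ ε C rep F) W m') ≤
      ENNReal.ofReal (2 * (2 : ℝ) ^ ((1 / 2 : ℝ) *
        (n + Real.logb 2 (Fintype.card M) - Real.logb 2 (Fintype.card C) - θ.lB)) + 8 * θ.εB) := by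
  set ρ : Word n → (H →L[ℂ] H) := fun x => ((2 : ℂ) ^ n)⁻¹ • W x with hρ
  have hρe : ρ = fun x => (((((2 : ℝ) ^ n)⁻¹ : ℝ)) : ℂ) • W x := by simp [hρ]
  have hρp : ∀ x, (ρ x).IsPositive := fun x => by
    rw [hρe]; exact isPositive_ofReal_smul (hW.1 x).1 (by positivity)
  -- The factor `√2` lost to the absolute row sums leaves room to give up one bit of min-entropy.
  have hl : ((θ.lB - 1 : ℝ) : EReal) < smoothCondMinEntropy θ.εB (blockDiag ρ) :=
    lt_of_lt_of_le (by exact_mod_cast sub_one_lt θ.lB) hW.2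
  obtain ⟨A, τ, hA, hA1, hτ, hAτ, hAρ⟩ := exists_le_state_of_lt_smoothCondMinEntropy hl
  set K : ℝ := √(Fintype.card (S × M × Coset C) *
    (2 / Fintype.card S * 2 ^ (-(θ.lB - 1)))) with hK
  have hbound : ∀ m, traceNorm (blockDiag fun t => ∑ x, (hashCoeff hrep F m t x : ℂ) • ρ x) ≤
      ENNReal.ofReal K + ENNReal.ofReal (4 * θ.εB) := by
    intro m
    have h := traceNorm_blockDiag_sum_smul_le (hashCoeff hrep F m) (by positivity) (by positivity)
      (sum_abs_hashCoeff_le hrep F m) (sum_abs_sum_hashCoeff_mul_le hrep F m) hρp hA hA1 hτ hAτ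
    refine h.trans (add_le_add le_rfl ?_)
    refine (mul_le_mul_right hAρ _).trans_eq ?_
    rw [show (2 : ℝ≥0∞) = ENNReal.ofReal 2 by simp, ← ENNReal.ofReal_mul two_pos.le,
      ← ENNReal.ofReal_mul two_pos.le]
    ring_nf
  have hdiff : bobState (protocol θ ε C rep F) W m - bobState (protocol θ ε C rep F) W m' =
      blockDiag (fun t => ∑ x, (hashCoeff hrep F m t x : ℂ) • ρ x) -
        blockDiag (fun t => ∑ x, (hashCoeff hrep F m' t x : ℂ) • ρ x) := by
    ext v t
    simp only [bobState, _root_.sub_apply, PiLp.sub_apply, blockDiag_apply]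
    simp only [← _root_.sub_apply, ← Finset.sum_sub_distrib, ← sub_smul, ← Complex.ofReal_sub]
    congr 1
    refine Finset.sum_congr rfl fun x _ => ?_
    rw [commit_toReal_sub hrep, hρe, smul_smul, ← Complex.ofReal_mul]
  have hKle : K ≤ 2 * (2 : ℝ) ^ ((1 / 2 : ℝ) *
      (n + Real.logb 2 (Fintype.card M) - Real.logb 2 (Fintype.card C) - θ.lB)) := by
    have hS : (0 : ℝ) < Fintype.card S := by exact_mod_cast Fintype.card_pos
    have hM : (0 : ℝ) < Fintype.card M := by exact_mod_cast Fintype.card_pos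
    have hC : (0 : ℝ) < Fintype.card C := by exact_mod_cast Fintype.card_pos
    have hcos : (Fintype.card (Coset C) : ℝ) * Fintype.card C = 2 ^ n := by
      exact_mod_cast card_coset_mul_card C
    rw [hK]
    refine Real.sqrt_le_iff.2 ⟨by positivity, le_of_eq ?_⟩
    rw [mul_pow, ← Real.rpow_natCast (2 ^ _), ← Real.rpow_mul two_pos.le,
      show (1 / 2 : ℝ) * (n + Real.logb 2 (Fintype.card M) - Real.logb 2 (Fintype.card C) - θ.lB) *
        (2 : ℕ) = n + Real.logb 2 (Fintype.card M) - Real.logb 2 (Fintype.card C) + -θ.lB by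
        push_cast; ring,
      Real.rpow_add two_pos, Real.rpow_sub two_pos, Real.rpow_add two_pos,
      Real.rpow_logb two_pos (by norm_num) hM, Real.rpow_logb two_pos (by norm_num) hC,
      show -(θ.lB - 1) = -θ.lB + 1 by ring, Real.rpow_add two_pos, Real.rpow_natCast, ← hcos]
    simp only [Fintype.card_prod, Nat.cast_mul, Real.rpow_one]
    field_simp
  rw [gtd, posTrace_bobState _ hW.1, posTrace_bobState _ hW.1, sub_self, abs_zero,
    ENNReal.ofReal_zero, mul_zero, add_zero, hdiff]
  calc _ ≤ 2⁻¹ * (2 * (ENNReal.ofReal K + ENNReal.ofReal (4 * θ.εB))) := by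
        refine mul_le_mul_right ((traceNorm_sub_le _ _).trans ?_) _
        rw [two_mul]
        exact add_le_add (hbound m) (hbound m')
    _ = ENNReal.ofReal (K + 4 * θ.εB) := by
        rw [← mul_assoc, ENNReal.inv_mul_cancel two_ne_zero ENNReal.ofNat_ne_top, one_mul,
          ENNReal.ofReal_add (Real.sqrt_nonneg _) (mul_nonneg (by norm_num) θ.εB_nonneg)]
    _ ≤ _ := ENNReal.ofReal_le_ofReal (by linarith [θ.εB_nonneg])

theorem hidingError_le (hrep : ∀ q, Submodule.Quotient.mk (rep q) = q) (θ : Params) (ε : ℝ)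
    (F : BalancedUHF S C M) :
    hidingError.{u} θ (protocol θ ε C rep F) ≤
      ENNReal.ofReal (2 * (2 : ℝ) ^ ((1 / 2 : ℝ) *
        (n + Real.logb 2 (Fintype.card M) - Real.logb 2 (Fintype.card C) - θ.lB)) + 8 * θ.εB) :=
  iSup_le fun _ => iSup_le fun _ => iSup_le fun _ => iSup_le fun _ => iSup_le fun _ =>
    iSup_le fun hW => iSup_le fun m => iSup_le fun m' => iSup_le fun _ =>
      gtd_bobState_le hrep θ ε F hW m m'

end Hiding

/-! ### Discrete probability and words -/

section Discrete

theorem toOuterMeasure_bind_le {α β : Type*} (p : PMF α) (f : α → PMF β) {s : Set β} {c : ℝ≥0∞}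
    (h : ∀ a ∈ p.support, (f a).toOuterMeasure s ≤ c) : (p.bind f).toOuterMeasure s ≤ c := by
  rw [PMF.toOuterMeasure_bind_apply]
  calc _ ≤ ∑' a, p a * c := by
        refine ENNReal.tsum_le_tsum fun a => ?_
        by_cases ha : a ∈ p.support
        · exact mul_le_mul_right (h a ha) _
        · rw [(PMF.apply_eq_zero_iff p a).2 ha, zero_mul, zero_mul]
    _ = c := by rw [ENNReal.tsum_mul_right, p.tsum_coe, one_mul]

/-- A weighted sum over all words whose weights factor over the letters. -/
theorem sum_word_prod {n : ℕ} (w : Fin n → ZMod 2 → ℝ) :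
    ∑ z : Word n, ∏ i, w i (z i) = ∏ i, (w i 0 + w i 1) := by
  have h := Fintype.prod_sum w
  rw [← h]
  exact Finset.prod_congr rfl fun i _ => Fin.sum_univ_two (w i)

theorem pow_hammingDist {n : ℕ} (r : ℝ) (x z : Word n) :
    r ^ hammingDist x z = ∏ i, if x i = z i then 1 else r := by
  rw [hammingDist, ← Finset.prod_const, Finset.prod_filter]
  exact Finset.prod_congr rfl fun i _ => by split_ifs <;> simp_all

end Discrete

/-! ### Intersections of Hamming balls -/

section Counting

variable {n : ℕ}

/-- A letter on which `x` and `y` differ contributes the factor `2 r`, every other letter the factor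
`1 + r ^ 2 ≥ 2 r`, so the sum is largest when `x` and `y` are as close as allowed. -/
theorem sum_pow_hammingDist_mul_le (x y : Word n) {r : ℝ} (hr : 0 ≤ r) {d : ℕ}
    (hd : d ≤ hammingDist x y) (hdn : d ≤ n) :
    ∑ z, r ^ hammingDist x z * r ^ hammingDist y z ≤ (2 * r) ^ d * (1 + r ^ 2) ^ (n - d) := by
  have h2r : 2 * r ≤ 1 + r ^ 2 := by nlinarith [sq_nonneg (r - 1)]
  have hx : hammingDist x y ≤ n := by simpa using hammingDist_le_card_fintype (x := x) (y := y)
  have hletter : ∀ a b : ZMod 2,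
      (if a = 0 then 1 else r) * (if b = 0 then 1 else r) +
        (if a = 1 then 1 else r) * (if b = 1 then 1 else r) =
      if a ≠ b then 2 * r else 1 + r ^ 2 := by
    have h2 : ∀ a : ZMod 2, a = 0 ∨ a = 1 := by decide
    have h10 : (1 : ZMod 2) ≠ 0 := by decide
    intro a b
    rcases h2 a with rfl | rfl <;> rcases h2 b with rfl | rfl <;> simp [h10, h10.symm] <;> ring
  calc ∑ z, r ^ hammingDist x z * r ^ hammingDist y z
      = ∏ i, if x i ≠ y i then 2 * r else 1 + r ^ 2 := by
        simp only [pow_hammingDist, ← Finset.prod_mul_distrib]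
        rw [sum_word_prod fun i b => (if x i = b then 1 else r) * (if y i = b then 1 else r)]
        exact Finset.prod_congr rfl fun i _ => hletter _ _
    _ = (2 * r) ^ hammingDist x y * (1 + r ^ 2) ^ (n - hammingDist x y) := by
        rw [Finset.prod_ite, Finset.prod_const, Finset.prod_const]
        congr 2
        have h := Finset.card_filter_add_card_filter_not (s := (Finset.univ : Finset (Fin n)))
          (fun i => x i ≠ y i)
        rw [Finset.card_univ, Fintype.card_fin] at h
        exact (Nat.sub_eq_of_eq_add' h.symm).symm
    _ ≤ _ := by
        obtain ⟨j, hj⟩ := Nat.exists_eq_add_of_le hd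
        rw [hj, show n - d = j + (n - (d + j)) by omega, pow_add, pow_add (1 + r ^ 2), mul_assoc]
        refine mul_le_mul_of_nonneg_left (mul_le_mul_of_nonneg_right ?_ (by positivity))
          (by positivity)
        exact pow_le_pow_left₀ (by positivity) h2r j

/-- Two Hamming balls of radius `L` whose centres are at distance at least `d`: by a Chernoff-type
weighting, their intersection is small. -/
theorem card_inter_hammingBall_le (x y : Word n) {d : ℕ} (hd : d ≤ hammingDist x y) (hdn : d ≤ n)
    (L : ℝ) {s : Finset (Word n)}
    (hs : ∀ z ∈ s, (hammingDist x z : ℝ) ≤ L ∧ (hammingDist y z : ℝ) ≤ L)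
    {r : ℝ} (hr : 0 < r) (hr1 : r ≤ 1) :
    (s.card : ℝ) ≤ 2 ^ d * (1 + r ^ 2) ^ (n - d) * r ^ ((d : ℝ) - 2 * L) := by
  have h1 : (s.card : ℝ) * r ^ (2 * L) ≤ (2 * r) ^ d * (1 + r ^ 2) ^ (n - d) := by
    refine le_trans ?_ (sum_pow_hammingDist_mul_le x y hr.le hd hdn)
    rw [← nsmul_eq_mul, ← Finset.sum_const]
    refine (Finset.sum_le_sum fun z hz => ?_).trans
      (Finset.sum_le_sum_of_subset_of_nonneg s.subset_univ fun z _ _ => by positivity)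
    rw [← pow_add, ← Real.rpow_natCast]
    refine Real.rpow_le_rpow_of_exponent_ge hr hr1 ?_
    push_cast
    linarith [(hs z hz).1, (hs z hz).2]
  rw [Real.rpow_sub hr, Real.rpow_natCast, mul_div_assoc', le_div_iff₀ (Real.rpow_pos_of_pos hr _)]
  refine h1.trans_eq ?_
  rw [mul_pow]
  ring

/-- The bound of `card_inter_hammingBall_le` at the optimal weight `r`. The argument of the entropy
may be negative, but then the intersection is empty. -/
theorem card_inter_hammingBall_le_binEntropy (x y : Word n) {d : ℕ} (hd : d ≤ hammingDist x y)
    (hdn : 2 * d < n) {P σ : ℝ} (hσ : (d : ℝ) = 2 * σ * n) (hP : P < 1 / 2)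
    {s : Finset (Word n)}
    (hs : ∀ z ∈ s, (hammingDist x z : ℝ) ≤ n * P ∧ (hammingDist y z : ℝ) ≤ n * P) :
    (s.card : ℝ) ≤ 2 ^ (n * ((1 - 2 * σ) * binEntropy₂ ((P - σ) / (1 - 2 * σ)) + 2 * σ)) := by
  have hn : (0 : ℝ) < n := by
    have : 0 < n := by omega
    exact_mod_cast this
  have hnd : ((n - d : ℕ) : ℝ) = n * (1 - 2 * σ) := by
    rw [Nat.cast_sub (by omega), hσ]; ring
  have hσ1 : 0 < 1 - 2 * σ := by
    have : (0 : ℝ) < ((n - d : ℕ) : ℝ) := by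
      have : 0 < n - d := by omega
      exact_mod_cast this
    rw [hnd] at this
    exact (pos_iff_pos_of_mul_pos this).1 hn
  set u := (P - σ) / (1 - 2 * σ) with hu
  have hPu : P - σ = u * (1 - 2 * σ) := by rw [hu, div_mul_cancel₀ _ hσ1.ne']
  have hu2 : u < 1 / 2 := by rw [hu, div_lt_iff₀ hσ1]; linarith
  have key := fun r hr hr1 => card_inter_hammingBall_le x y hd (by omega) (n * P) hs (r := r) hr hr1
  have hexp : (d : ℝ) - 2 * (n * P) = -(2 * (n * (1 - 2 * σ)) * u) := by
    rw [hσ]; linear_combination (-2 * n : ℝ) * hPu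
  rw [hexp] at key
  rcases lt_trichotomy u 0 with h0 | h0 | h0
  · -- The centres are too far apart for the balls to meet.
    have : s = ∅ := by
      refine Finset.eq_empty_of_forall_notMem fun z hz => ?_
      have h1 := hs z hz
      have h2 : (hammingDist x y : ℝ) ≤ hammingDist x z + hammingDist y z := by
        rw [hammingDist_comm y z]
        exact_mod_cast hammingDist_triangle x z y
      have h3 : (d : ℝ) ≤ hammingDist x y := by exact_mod_cast hd
      have h4 : 0 < -(2 * (n * (1 - 2 * σ)) * u) := by
        have : 0 < n * (1 - 2 * σ) := by positivity
        nlinarith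
      linarith [h1.1, h1.2]
    rw [this, Finset.card_empty, Nat.cast_zero]
    positivity
  · -- Let the weight `r` tend to `0`.
    rw [h0, binEntropy₂, Real.binEntropy_zero, zero_div, mul_zero, zero_add,
      show n * (2 * σ) = (d : ℝ) by rw [hσ]; ring, Real.rpow_natCast]
    have hlim : Filter.Tendsto (fun r : ℝ => 2 ^ d * (1 + r ^ 2) ^ (n - d))
        (nhdsWithin 0 (Set.Ioi 0)) (nhds (2 ^ d * (1 + 0 ^ 2) ^ (n - d))) :=
      (Continuous.tendsto (by fun_prop) 0).mono_left nhdsWithin_le_nhds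
    rw [zero_pow two_ne_zero, add_zero, one_pow, mul_one] at hlim
    refine ge_of_tendsto hlim ?_
    filter_upwards [Ioo_mem_nhdsGT (show (0 : ℝ) < 1 by norm_num)] with r hr
    simpa [h0] using key r hr.1 hr.2.le
  · -- The optimal weight has `r ^ 2 = u / (1 - u)`.
    have hu1 : 0 < 1 - u := by linarith
    have hr2 : 0 < u / (1 - u) := by positivity
    have hsq : √(u / (1 - u)) ^ 2 = u / (1 - u) := Real.sq_sqrt hr2.le
    refine (key √(u / (1 - u)) (Real.sqrt_pos.2 hr2) ?_).trans_eq ?_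
    · refine Real.sqrt_le_iff.2 ⟨zero_le_one, ?_⟩
      rw [one_pow, div_le_one hu1]; linarith
    · rw [hsq, show 1 + u / (1 - u) = (1 - u)⁻¹ by field_simp; ring, ← Real.rpow_natCast,
        ← Real.rpow_natCast, hnd, Real.rpow_def_of_pos two_pos,
        Real.rpow_def_of_pos (by positivity), Real.rpow_def_of_pos (Real.sqrt_pos.2 hr2),
        Real.rpow_def_of_pos two_pos, ← Real.exp_add, ← Real.exp_add, Real.log_sqrt hr2.le,
        Real.log_div h0.ne' hu1.ne', Real.log_inv, binEntropy₂, Real.binEntropy, Real.log_inv,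
        Real.log_inv, hσ]
      congr 1
      have hl2 : Real.log 2 ≠ 0 := (Real.log_pos one_lt_two).ne'
      field_simp
      ring

end Counting

/-! ### Binding -/

section Binding

variable {n : ℕ}

/-- The generalized trace distance dominates the difference of the probabilities of any event, also
for distributions of different total mass. -/
theorem sum_le_of_classicalGtd_le {α : Type*} [Fintype α] {P Q : α → ℝ} {ε : ℝ}
    (h : classicalGtd Q P ≤ ε) (s : Finset α) : ∑ a ∈ s, P a ≤ ∑ a ∈ s, Q a + ε := by
  rw [classicalGtd] at h
  have h1 : ∑ a ∈ s, (P a - Q a) ≤ ∑ a, (|Q a - P a| - (Q a - P a)) / 2 := by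
    refine (Finset.sum_le_sum fun a _ => ?_).trans
      (Finset.sum_le_sum_of_subset_of_nonneg s.subset_univ fun a _ _ => ?_)
    · linarith [neg_abs_le (Q a - P a)]
    · linarith [le_abs_self (Q a - P a)]
  rw [Finset.sum_sub_distrib, ← Finset.sum_div, Finset.sum_sub_distrib] at h1
  linarith [neg_abs_le (∑ a, (Q a - P a))]

theorem sum_le_of_le_smoothMinEntropy {α : Type*} [Fintype α] {P : α → ℝ} {ε l : ℝ}
    (h : (l : EReal) ≤ smoothMinEntropy ε P) (s : Finset α) :
    ∑ a ∈ s, P a ≤ s.card * 2 ^ (-l) + ε := by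
  have hlim : Filter.Tendsto (fun l' : ℝ => s.card * (2 : ℝ) ^ (-l') + ε) (nhdsWithin l (Set.Iio l))
      (nhds (s.card * 2 ^ (-l) + ε)) :=
    (Continuous.tendsto (by fun_prop (disch := norm_num)) l).mono_left nhdsWithin_le_nhds
  refine ge_of_tendsto hlim ?_
  filter_upwards [self_mem_nhdsWithin] with l' hl'
  have h' : (l' : EReal) < smoothMinEntropy ε P :=
    lt_of_lt_of_le (by exact_mod_cast hl') h
  simp only [smoothMinEntropy, lt_iSup_iff] at h'
  obtain ⟨Q, -, hQ, hl⟩ := h'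
  rw [minEntropy, EReal.lt_neg_comm] at hl
  simp only [iInf_lt_iff] at hl
  obtain ⟨r, hr, hrl⟩ := hl
  have hrl' : r < -l' := by exact_mod_cast hrl
  refine (sum_le_of_classicalGtd_le hQ s).trans (add_le_add ?_ le_rfl)
  rw [← nsmul_eq_mul, ← Finset.sum_const]
  exact Finset.sum_le_sum fun a _ =>
    (hr a).trans (Real.rpow_le_rpow_of_exponent_le one_le_two hrl'.le)

/-- It suffices to bound the probability of cheating for fixed announcements `b₀`, `b₁`. -/
theorem toOuterMeasure_cheatRun_le {T A X Q : Type*} (WA : X → PMF (Word n))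
    (aC : PMF (X × T × Q)) (a₀ a₁ : X × T × Q → PMF A) {s : Set (Word n × T × A × A)} {c : ℝ≥0∞}
    (h : ∀ x t b₀ b₁, (WA x).toOuterMeasure {z | (z, t, b₀, b₁) ∈ s} ≤ c) :
    (cheatRun WA aC a₀ a₁).toOuterMeasure s ≤ c := by
  refine toOuterMeasure_bind_le _ _ fun v _ => ?_
  -- Given her view `v`, the channel output is independent of the announcements.
  rw [PMF.bind_comm]
  refine toOuterMeasure_bind_le _ _ fun b₀ _ => ?_
  simp only [← PMF.bind_pure_comp]
  rw [PMF.bind_comm]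
  refine toOuterMeasure_bind_le _ _ fun b₁ _ => ?_
  refine le_trans (le_of_eq ?_) (h v.1 v.2.1 b₀ b₁)
  exact PMF.toOuterMeasure_map_apply (fun z => (z, v.2.1, b₀, b₁)) (WA v.1) s

theorem bindingError_le {M : Type*} {S : Type*}
    [AddGroup M] [Fintype M] [Fintype S] [Nonempty S]
    (θ : Params) (ε : ℝ) (C : Code n) (rep : Coset C → Word n) (F : BalancedUHF S C M)
    {d : ℕ} (hd : IsMinDist C d) (hdn : 2 * d < n) {σ : ℝ} (hσ : (d : ℝ) = 2 * σ * n)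
    (hε : ε < 1 / 2 - θ.p) :
    bindingError.{v} θ (protocol θ ε C rep F) ≤ ENNReal.ofReal
      (2 ^ (n * ((1 - 2 * σ) * binEntropy₂ ((θ.p - σ + ε) / (1 - 2 * σ)) + 2 * σ) - θ.lA)
        + θ.εA) := by
  refine iSup_le fun X => iSup_le fun WA => iSup_le fun hWA => iSup_le fun Q => iSup_le fun aC =>
    iSup_le fun a₀ => iSup_le fun a₁ => toOuterMeasure_cheatRun_le WA aC a₀ a₁ ?_
  rintro x t ⟨m₀, c₀⟩ ⟨m₁, c₁⟩
  classical
  set E : Finset (Word n) := Finset.univ.filter fun z => (z, t, (m₀, c₀), (m₁, c₁)) ∈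
    {v : Word n × (S × M × Coset C) × (M × Word n) × (M × Word n) |
      (protocol θ ε C rep F).accept v.1 v.2.1 v.2.2.1 ∧
      (protocol θ ε C rep F).accept v.1 v.2.1 v.2.2.2 ∧
      (protocol θ ε C rep F).output v.1 v.2.1 v.2.2.1 ≠
        (protocol θ ε C rep F).output v.1 v.2.1 v.2.2.2} with hE
  have hcard : (E.card : ℝ) ≤
      2 ^ (n * ((1 - 2 * σ) * binEntropy₂ ((θ.p - σ + ε) / (1 - 2 * σ)) + 2 * σ)) := by
    rcases E.eq_empty_or_nonempty with h0 | ⟨z, hz⟩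
    · rw [h0, Finset.card_empty, Nat.cast_zero]; positivity
    · -- Words with the same hash value and mask announce the same message.
      obtain ⟨-, ⟨h₀, hf₀, -⟩, ⟨h₁, hf₁, -⟩, hne⟩ := Finset.mem_filter.1 hz
      have hc : c₀ ≠ c₁ := by
        rintro rfl
        exact hne (add_right_cancel (hf₀.symm.trans hf₁))
      have hdist : d ≤ hammingDist (c₀ + rep t.2.2) (c₁ + rep t.2.2) := by
        refine hd.2 ⟨c₀, h₀, c₁, h₁, hc, ?_⟩
        simp [hammingDist]
      rw [show θ.p - σ + ε = (θ.p + ε) - σ by ring]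
      refine card_inter_hammingBall_le_binEntropy _ _ hdist hdn hσ (by linarith) fun z hz => ?_
      obtain ⟨-, ⟨-, -, -, hz₀⟩, ⟨-, -, -, hz₁⟩, -⟩ := Finset.mem_filter.1 hz
      exact ⟨hz₀, hz₁⟩
  have hsum := sum_le_of_le_smoothMinEntropy (hWA x) E
  calc _ = ∑ z ∈ E, WA x z := by
        rw [← PMF.toOuterMeasure_apply_finset]
        congr 1
        ext z
        simp [hE]
    _ = ENNReal.ofReal (∑ z ∈ E, (WA x z).toReal) := by
        rw [ENNReal.ofReal_sum_of_nonneg fun _ _ => ENNReal.toReal_nonneg]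
        exact Finset.sum_congr rfl fun z _ => (ENNReal.ofReal_toReal (PMF.apply_ne_top _ _)).symm
    _ ≤ _ := by
        refine ENNReal.ofReal_le_ofReal (hsum.trans (add_le_add ?_ le_rfl))
        rw [sub_eq_add_neg, Real.rpow_add two_pos]
        exact mul_le_mul_of_nonneg_right hcard (by positivity)

end Binding

/-! ### Completeness -/

section Completeness

/-- Hoeffding's lemma for a Bernoulli variable. -/
theorem bernoulli_mgf_le {p : ℝ} (hp0 : 0 ≤ p) (hp1 : p ≤ 1) (t : ℝ) :
    1 - p + p * Real.exp t ≤ Real.exp (t * p + t ^ 2 / 8) := by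
  open MeasureTheory ProbabilityTheory in
  let μ : Measure ℝ := ENNReal.ofReal (1 - p) • Measure.dirac 0 + ENNReal.ofReal p • Measure.dirac 1
  have hprob : IsProbabilityMeasure μ := ⟨by
    simp only [μ, Measure.add_apply, Measure.smul_apply, measure_univ, smul_eq_mul, mul_one]
    rw [← ENNReal.ofReal_add (by linarith) hp0]
    simp⟩
  have hint : ∀ f : ℝ → ℝ, ∫ x, f x ∂μ = (1 - p) * f 0 + p * f 1 := by
    intro f
    have h1 : ∀ (c : ℝ) (a : ℝ), Integrable f (ENNReal.ofReal c • Measure.dirac a) := fun c a =>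
      (integrable_dirac (by simp)).smul_measure ENNReal.ofReal_ne_top
    rw [integral_add_measure (h1 _ _) (h1 _ _), integral_smul_measure, integral_smul_measure,
      integral_dirac, integral_dirac, ENNReal.toReal_ofReal (by linarith),
      ENNReal.toReal_ofReal hp0]
    simp
  have hmem : ∀ᵐ x ∂μ, id x ∈ Set.Icc (0 : ℝ) 1 := by
    refine ae_add_measure_iff.2 ⟨Measure.ae_smul_measure ?_ _, Measure.ae_smul_measure ?_ _⟩ <;>
      simp [ae_dirac_eq]
  have h := (hasSubgaussianMGF_of_mem_Icc (μ := μ) (X := id) aemeasurable_id hmem).mgf_le t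
  rw [mgf, hint, hint] at h
  have he : 1 - p + p * Real.exp t =
      Real.exp (t * p) * ((1 - p) * Real.exp (t * (0 - p)) + p * Real.exp (t * (1 - p))) := by
    rw [mul_add, mul_left_comm, mul_left_comm _ p, ← Real.exp_add, ← Real.exp_add]
    ring_nf
    simp only [Real.exp_zero]
    ring
  rw [he, Real.exp_add]
  refine mul_le_mul_of_nonneg_left ?_ (Real.exp_pos _).le
  refine le_trans (le_of_eq ?_) (h.trans_eq ?_)
  · simp
  · congr 1
    simp
    ring

variable {n : ℕ}

theorem bsc_toReal (θ : Params) (x z : Word n) :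
    (bsc θ n x z).toReal = ∏ i, if z i = x i then 1 - θ.p else θ.p := by
  have h0 := θ.p_pos
  have h1 := θ.p_lt
  rw [bsc, PMF.ofFintype_apply, ENNReal.toReal_prod]
  refine Finset.prod_congr rfl fun i _ => ?_
  split_ifs
  · exact ENNReal.toReal_ofReal (by linarith)
  · exact ENNReal.toReal_ofReal h0.le

theorem sum_bsc_mul_exp_le (θ : Params) (x : Word n) (t : ℝ) :
    ∑ z, (bsc θ n x z).toReal * Real.exp (t * hammingDist x z) ≤
      Real.exp (n * (t * θ.p + t ^ 2 / 8)) := by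
  have hletter : ∀ a : ZMod 2,
      (if (0 : ZMod 2) = a then 1 - θ.p else θ.p) * (if a = 0 then 1 else Real.exp t) +
        (if (1 : ZMod 2) = a then 1 - θ.p else θ.p) * (if a = 1 then 1 else Real.exp t) =
      1 - θ.p + θ.p * Real.exp t := by
    have h2 : ∀ a : ZMod 2, a = 0 ∨ a = 1 := by decide
    have h10 : (1 : ZMod 2) ≠ 0 := by decide
    intro a
    rcases h2 a with rfl | rfl <;> simp [h10, h10.symm]
    ring
  have hp := bernoulli_mgf_le θ.p_pos.le (by linarith [θ.p_lt]) t
  calc _ = ∑ z : Word n, ∏ i, (if z i = x i then 1 - θ.p else θ.p) *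
        (if x i = z i then 1 else Real.exp t) := by
        refine Finset.sum_congr rfl fun z _ => ?_
        rw [bsc_toReal, mul_comm t, Real.exp_nat_mul, pow_hammingDist, Finset.prod_mul_distrib]
    _ = (1 - θ.p + θ.p * Real.exp t) ^ n := by
        rw [sum_word_prod fun i b => (if b = x i then 1 - θ.p else θ.p) *
          (if x i = b then 1 else Real.exp t)]
        simp only [hletter, Finset.prod_const, Finset.card_univ, Fintype.card_fin]
    _ ≤ _ := by
        rw [Real.exp_nat_mul]
        have : 0 ≤ 1 - θ.p + θ.p * Real.exp t := by
          have h0 := θ.p_pos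
          have h1 := θ.p_lt
          have := Real.exp_pos t
          nlinarith
        exact pow_le_pow_left₀ this hp n

/-- Hoeffding's inequality for the number of errors of the binary symmetric channel. -/
theorem bsc_compl_typicalSet_le (θ : Params) {ε : ℝ} (hε : 0 < ε) (x : Word n) :
    (bsc θ n x).toOuterMeasure (typicalSet θ.p ε x)ᶜ ≤
      ENNReal.ofReal (2 * Real.exp (-(2 * n * ε ^ 2))) := by
  classical
  -- Exponential Markov bounds for both tails, with the parameter `4 ε` that minimises
  -- `t ^ 2 / 8 - t ε`.
  have hpt : ∀ z ∈ (typicalSet θ.p ε x)ᶜ,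
      1 ≤ Real.exp (4 * ε * hammingDist x z) * Real.exp (-(4 * ε * (n * (θ.p + ε)))) +
        Real.exp (-(4 * ε) * hammingDist x z) * Real.exp (4 * ε * (n * (θ.p - ε))) := by
    intro z hz
    rw [← Real.exp_add, ← Real.exp_add]
    by_cases h1 : (n : ℝ) * (θ.p - ε) ≤ hammingDist x z
    · have h2 : (n : ℝ) * (θ.p + ε) < hammingDist x z := by
        by_contra! h2
        exact hz ⟨h1, h2⟩
      have h3 : 1 ≤ Real.exp (4 * ε * hammingDist x z + -(4 * ε * (n * (θ.p + ε)))) :=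
        Real.one_le_exp (by nlinarith)
      linarith [Real.exp_pos (-(4 * ε) * hammingDist x z + 4 * ε * (n * (θ.p - ε)))]
    · have h3 : 1 ≤ Real.exp (-(4 * ε) * hammingDist x z + 4 * ε * (n * (θ.p - ε))) :=
        Real.one_le_exp (by nlinarith [not_le.1 h1])
      linarith [Real.exp_pos (4 * ε * hammingDist x z + -(4 * ε * (n * (θ.p + ε))))]
  rw [show (typicalSet θ.p ε x)ᶜ = ((Finset.univ.filter (· ∈ (typicalSet θ.p ε x)ᶜ) :
    Finset (Word n)) : Set (Word n)) by ext; simp, PMF.toOuterMeasure_apply_finset]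
  calc _ = ENNReal.ofReal (∑ z ∈ Finset.univ.filter (· ∈ (typicalSet θ.p ε x)ᶜ),
        (bsc θ n x z).toReal) := by
        rw [ENNReal.ofReal_sum_of_nonneg fun _ _ => ENNReal.toReal_nonneg]
        exact Finset.sum_congr rfl fun z _ => (ENNReal.ofReal_toReal (PMF.apply_ne_top _ _)).symm
    _ ≤ _ := ENNReal.ofReal_le_ofReal ?_
  calc _ ≤ ∑ z, (bsc θ n x z).toReal *
        (Real.exp (4 * ε * hammingDist x z) * Real.exp (-(4 * ε * (n * (θ.p + ε)))) +
          Real.exp (-(4 * ε) * hammingDist x z) * Real.exp (4 * ε * (n * (θ.p - ε)))) := by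
        refine (Finset.sum_le_sum fun z hz => ?_).trans
          (Finset.sum_le_sum_of_subset_of_nonneg (Finset.subset_univ _) fun z _ _ => by positivity)
        exact le_mul_of_one_le_right ENNReal.toReal_nonneg (hpt z (Finset.mem_filter.1 hz).2)
    _ = (∑ z, (bsc θ n x z).toReal * Real.exp (4 * ε * hammingDist x z)) *
          Real.exp (-(4 * ε * (n * (θ.p + ε)))) +
        (∑ z, (bsc θ n x z).toReal * Real.exp (-(4 * ε) * hammingDist x z)) *
          Real.exp (4 * ε * (n * (θ.p - ε))) := by
        simp only [mul_add, Finset.sum_add_distrib, Finset.sum_mul, mul_assoc]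
    _ ≤ Real.exp (n * (4 * ε * θ.p + (4 * ε) ^ 2 / 8)) * Real.exp (-(4 * ε * (n * (θ.p + ε)))) +
        Real.exp (n * (-(4 * ε) * θ.p + (-(4 * ε)) ^ 2 / 8)) *
          Real.exp (4 * ε * (n * (θ.p - ε))) :=
        add_le_add
          (mul_le_mul_of_nonneg_right (sum_bsc_mul_exp_le θ x _) (Real.exp_pos _).le)
          (mul_le_mul_of_nonneg_right (sum_bsc_mul_exp_le θ x _) (Real.exp_pos _).le)
    _ = _ := by
        rw [← Real.exp_add, ← Real.exp_add, two_mul (Real.exp _)]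
        congr 2 <;> ring

theorem completenessError_le {M S : Type*} [AddGroup M] [Fintype M] [Fintype S] [Nonempty S]
    (θ : Params) {ε : ℝ} (hε : 0 < ε) (C : Code n) (rep : Coset C → Word n)
    (F : BalancedUHF S C M) :
    completenessError θ (protocol θ ε C rep F) ≤
      ENNReal.ofReal (2 * Real.exp (-(2 * n * ε ^ 2))) := by
  classical
  refine iSup_le fun m => ?_
  set E := {v : Word n × (S × M × Coset C) × (M × Word n) |
    (protocol θ ε C rep F).output v.1 v.2.1 v.2.2 = m ∧
      (protocol θ ε C rep F).accept v.1 v.2.1 v.2.2} with hE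
  set P := (honestRun θ (protocol θ ε C rep F) m).toOuterMeasure
  have h1 : 1 ≤ P E + P Eᶜ := by
    rw [← show P Set.univ = 1 from (PMF.toOuterMeasure_apply_eq_one_iff _ _).2 (Set.subset_univ _),
      ← Set.union_compl_self E]
    exact MeasureTheory.measure_union_le _ _
  refine (tsub_le_iff_left.2 h1).trans (toOuterMeasure_bind_le _ _ fun w hw => ?_)
  rw [protocol_commit] at hw
  simp only [PMF.mem_support_bind_iff, PMF.mem_support_map_iff] at hw
  obtain ⟨s, -, k, -, q, -, c, hc, rfl⟩ := hw
  have hf : F.f s c = m + k := by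
    by_contra h
    exact (PMF.mem_support_iff _ _).1 hc (by simp [BalancedUHF.invMap, h])
  rw [PMF.toOuterMeasure_map_apply]
  refine le_trans ?_ (bsc_compl_typicalSet_le θ hε ((c : Word n) + rep q))
  refine MeasureTheory.measure_mono fun z hz => ?_
  exact fun hz' => hz ⟨rfl, c.2, hf, hz'⟩

end Completeness

end UsNC

end

theorem theorem1 {n : ℕ} {M : Type w₁} {S : Type w₂}
    [AddGroup M] [Fintype M] [Fintype S] [Nonempty S]
    (θ : UsNC.Params) (ε : ℝ) (hε : 0 < ε)
    (C : UsNC.Code n) (rep : UsNC.Coset C → UsNC.Word n)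
    (hrep : ∀ q, Submodule.Quotient.mk (rep q) = q)
    (F : UsNC.BalancedUHF S C M)
    (d : ℕ) (hd : UsNC.IsMinDist C d) (hdn : 2 * d < n)
    (σ : ℝ) (hσ : (d : ℝ) = 2 * σ * n) :
    UsNC.completenessError θ (UsNC.protocol θ ε C rep F)
        ≤ ENNReal.ofReal (8 * (2 : ℝ) ^ (-(n * ε ^ 2))) ∧
    UsNC.hidingError.{u} θ (UsNC.protocol θ ε C rep F)
        ≤ ENNReal.ofReal (2 * (2 : ℝ) ^ ((1 / 2 : ℝ) *
            (n + Real.logb 2 (Fintype.card M) - Real.logb 2 (Fintype.card C) - θ.lB))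
          + 8 * θ.εB) ∧
    (ε < 1 / 2 - θ.p →
      UsNC.bindingError.{v} θ (UsNC.protocol θ ε C rep F)
        ≤ ENNReal.ofReal ((√2 * ε * n + 1) ^ 2 *
            (2 : ℝ) ^ (n * ((1 - 2 * σ) * UsNC.binEntropy₂ ((θ.p - σ + ε) / (1 - 2 * σ)) + 2 * σ)
              - θ.lA)
          + θ.εA)) := by
  refine ⟨?_, UsNC.hidingError_le hrep θ ε F, fun hεp => ?_⟩
  · refine (UsNC.completenessError_le θ hε C rep F).trans (ENNReal.ofReal_le_ofReal ?_)
    refine mul_le_mul (by norm_num) ?_ (Real.exp_pos _).le (by norm_num)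
    rw [Real.rpow_def_of_pos two_pos]
    refine Real.exp_le_exp.2 ?_
    have h1 : 0 ≤ n * ε ^ 2 := by positivity
    have h2 : Real.log 2 ≤ 2 := by linarith [Real.log_two_lt_d9]
    nlinarith
  -- The counting bound holds without the polynomial prefactor, which is at least `1`.
  · refine (UsNC.bindingError_le θ ε C rep F hd hdn hσ hεp).trans (ENNReal.ofReal_le_ofReal ?_)
    refine add_le_add (le_mul_of_one_le_left (by positivity) ?_) le_rfl
    have : 0 ≤ √2 * ε * n := by positivity
    exact one_le_pow₀ (by linarith)
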